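/- Let $\{X_t\}_{t\ge 1}$ be a time-homogeneous Markov chain on a measurable space $\mathcal X$ with transition kernel $\mathcal P$ and arbitrary initial distribution. Let $\tilde A:\mathcal X\to\mathbb R^{d\times d}$ and $\tilde b:\mathcal X\to\mathbb R^d$ be measurable. Assume: (A1) The chain is uniformly ergodic with (unique) stationary distribution $\mu$, i.e. $\mu\mathcal P=\mu$ and $\sup_{x\in\mathcal X}\|\mathcal P^t(x,\cdot)-\mu\|_{TV}\to 0$ as $t\to\infty$. (A2) (i) There are $\bar A\in\mathbb R^{d\times d}$ and $\bar b\in\mathbb R^d$ with $\bar A=\lim_{t\to\infty}\mathbb E[\tilde A(X_t)]$ and $\bar b=\lim_{t\to\infty}\mathbb E[\tilde b(X_t)]$; (ii) $\bar A$ is Hurwitz, i.e. all its eigenvalues have strictly negative real part (so $\bar A$ is invertible); (iii) $\sup_{x}\|\tilde A(x)\|_F<\infty$ and $\sup_x\|\tilde b(x)\|_2<\infty$. (A3) $\alpha_t=\alpha_0/t^{\eta}$ for $t\ge 1$, with $\alpha_0>0$ and $\eta\in(1/2,1)$. Let $\theta_*$ be the solution of $\bar A\theta=\bar b$. For deterministic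 initial values $\theta_0,\hat\theta_0\in\mathbb R^d$ define, for $t\ge 0$, $$\theta_{t+1}=\theta_t+\alpha_{t+1}\big(\tilde A(X_{t+1})\theta_t-\tilde b(X_{t+1})\big),\qquad \hat\theta_{t+1}=\hat\theta_t+\alpha_{t+1}W_{t+1}\big(\tilde A(X_{t+1})\hat\theta_t-\tilde b(X_{t+1})\big),$$ where $\{W_t\}_{t\ge 1}$ are bounded i.i.d. random variables with mean $1$ and variance $1$, independent of $\{X_t\}_{t\ge1}$. Put $\bar\theta_t=\frac1t\sum_{i=1}^t\theta_i$ and $\bar{\hat\theta}_t=\frac1t\sum_{i=1}^t\hat\theta_i$. Then, as $t\to\infty$, $$\sqrt t\,(\bar{\hat\theta}_t-\theta_*)=-\frac1{\sqrt t}\bar A^{-1}\sum_{i=1}^t W_{i+1}\big(\tilde A(X_{i+1})\theta_*-\tilde b(X_{i+1})\big)+o_p(1),$$ $$\sqrt t\,(\bar\theta_t-\theta_*)=-\frac1{\sqrt t}\bar A^{-1}\sum_{i=1}^t \big(\tilde A(X_{i+1})\theta_*-\tilde b(X_{i+1})\big)+o_p(1),$$ $$\sqrt t\,(\bar{\hat\theta}_t-\bar\theta_t)=-\frac1{\sqrt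 t}\bar A^{-1}\sum_{i=1}^t (W_{i+1}-1)\big(\tilde A(X_{i+1})\theta_*-\tilde b(X_{i+1})\big)+o_p(1),$$ where $o_p(1)$ denotes a sequence of random vectors converging to $0$ in probability. -/

import Mathlib

open MeasureTheory ProbabilityTheory Filter Topology
open scoped Matrix.Norms.Frobenius

noncomputable section

namespace LSA

/-- Total variation distance `sup_s |p s - q s|` (over measurable sets `s`) of two measures;
it is only used for probability measures. -/
def tvDist {S : Type*} [MeasurableSpace S] (p q : Measure S) : ℝ :=
  ⨆ s : {s : Set S // MeasurableSet s}, |p.real s.1 - q.real s.1|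

/-- The transition kernel `κ` is uniformly ergodic with stationary distribution `μ`:
`μ` is invariant and `sup_x ‖κ^t(x, ·) - μ‖_TV → 0` as `t → ∞`.
(Uniqueness of `μ` and the geometric rate are consequences.) -/
structure UniformlyErgodic {S : Type*} [MeasurableSpace S] (κ : Kernel S S) (μ : Measure S) :
    Prop where
  invariant : Kernel.Invariant κ μ
  tendsto : TendstoUniformly (fun (t : ℕ) (x : S) => tvDist ((κ ^ t) x) μ) (fun _ => 0) atTop

/-- The σ-algebra `σ(X_1, …, X_t)`. -/
abbrev history {Ω S : Type*} [MeasurableSpace S] (X : ℕ → Ω → S) (t : ℕ) : MeasurableSpace Ω :=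
  ⨆ i ∈ Finset.Icc 1 t, MeasurableSpace.comap (X i) inferInstance

/-- `(X_t)_{t ≥ 1}` is a time-homogeneous Markov chain under `P` with transition kernel `κ` and
arbitrary initial distribution: `P(X_{t+1} ∈ s | X_1, …, X_t) = κ(X_t, s)` almost surely.
The value `X 0` plays no role. -/
structure IsMarkovChain {Ω S : Type*} [MeasurableSpace Ω] [MeasurableSpace S]
    (P : Measure Ω) (κ : Kernel S S) (X : ℕ → Ω → S) : Prop where
  measurable : ∀ t, 1 ≤ t → Measurable (X t)
  markov : ∀ t, 1 ≤ t → ∀ s : Set S, MeasurableSet s →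
    P[(X (t + 1) ⁻¹' s).indicator (fun _ => (1 : ℝ)) | history X t]
      =ᵐ[P] fun ω => (κ (X t ω)).real s

/-- `(W_t)_{t ≥ 1}` are bootstrap weights: i.i.d., bounded, with mean one and variance one, and
independent of the observed chain `(X_t)_{t ≥ 1}`. The value `W 0` plays no role. -/
structure IsBootstrapWeights {Ω S : Type*} [MeasurableSpace Ω] [MeasurableSpace S]
    (P : Measure Ω) (X : ℕ → Ω → S) (W : ℕ → Ω → ℝ) : Prop where
  measurable : ∀ t, 1 ≤ t → Measurable (W t)
  indep : iIndepFun (fun t : ℕ => W (t + 1)) P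
  identDistrib : ∀ t, 1 ≤ t → IdentDistrib (W t) (W 1) P P
  bounded : ∃ Wmax : ℝ, ∀ᵐ ω ∂P, |W 1 ω| ≤ Wmax
  mean : ∫ ω, W 1 ω ∂P = 1
  variance : variance (W 1) P = 1
  indep_chain : IndepFun (fun ω (t : ℕ) => X (t + 1) ω) (fun ω (t : ℕ) => W (t + 1) ω) P

/-- A real square matrix is Hurwitz if all its complex eigenvalues have negative real part
(in particular it has full rank). -/
def IsHurwitz {d : ℕ} (A : Matrix (Fin d) (Fin d) ℝ) : Prop :=
  ∀ z : ℂ, Module.End.HasEigenvalue (Matrix.toLin' (A.map (algebraMap ℝ ℂ))) z → z.re < 0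

/-- The step sizes `α_t = α₀ / t ^ η`. -/
def stepSize (α₀ η : ℝ) (t : ℕ) : ℝ := α₀ / (t : ℝ) ^ η

/-- The linear stochastic approximation iterates
`θ_{t+1} = θ_t + α_{t+1} (A_{t+1} θ_t - b_{t+1})`, started from `θ₀`. -/
def lsa {d : ℕ} (α : ℕ → ℝ) (A : ℕ → Matrix (Fin d) (Fin d) ℝ)
    (b : ℕ → EuclideanSpace ℝ (Fin d)) (θ₀ : EuclideanSpace ℝ (Fin d)) :
    ℕ → EuclideanSpace ℝ (Fin d)
  | 0 => θ₀
  | t + 1 => lsa α A b θ₀ t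
      + α (t + 1) • (Matrix.toEuclideanLin (A (t + 1)) (lsa α A b θ₀ t) - b (t + 1))

/-- The perturbed linear stochastic approximation iterates
`θ_{t+1} = θ_t + α_{t+1} w_{t+1} (A_{t+1} θ_t - b_{t+1})`, started from `θ₀`. -/
def plsa {d : ℕ} (α : ℕ → ℝ) (w : ℕ → ℝ) (A : ℕ → Matrix (Fin d) (Fin d) ℝ)
    (b : ℕ → EuclideanSpace ℝ (Fin d)) (θ₀ : EuclideanSpace ℝ (Fin d)) :
    ℕ → EuclideanSpace ℝ (Fin d)
  | 0 => θ₀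
  | t + 1 => plsa α w A b θ₀ t
      + (α (t + 1) * w (t + 1)) •
        (Matrix.toEuclideanLin (A (t + 1)) (plsa α w A b θ₀ t) - b (t + 1))

/-- The Polyak–Ruppert average `(1/t) ∑_{i=1}^t θ_i`. -/
def average {d : ℕ} (θ : ℕ → EuclideanSpace ℝ (Fin d)) (t : ℕ) : EuclideanSpace ℝ (Fin d) :=
  (t : ℝ)⁻¹ • ∑ i ∈ Finset.Icc 1 t, θ i

/-- The linear term `-(1/√t) Ā⁻¹ ∑_{i=1}^t c_{i+1} (A_{i+1} θ - b_{i+1})`. -/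
def linearTerm {d : ℕ} (Abar : Matrix (Fin d) (Fin d) ℝ) (c : ℕ → ℝ)
    (A : ℕ → Matrix (Fin d) (Fin d) ℝ) (b : ℕ → EuclideanSpace ℝ (Fin d))
    (θ : EuclideanSpace ℝ (Fin d)) (t : ℕ) : EuclideanSpace ℝ (Fin d) :=
  -((Real.sqrt t)⁻¹ • Matrix.toEuclideanLin Abar⁻¹
      (∑ i ∈ Finset.Icc 1 t, c (i + 1) • (Matrix.toEuclideanLin (A (i + 1)) θ - b (i + 1))))

/-- `U_t = V_t + o_p(1)` as `t → ∞`: the difference converges to zero in probability. -/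
def EqUpToLittleOp {Ω : Type*} [MeasurableSpace Ω] {d : ℕ} (P : Measure Ω)
    (U V : ℕ → Ω → EuclideanSpace ℝ (Fin d)) : Prop :=
  TendstoInMeasure P (fun t ω => U t ω - V t ω) atTop (fun _ => 0)

end LSA

end

/-!
Along the Poisson equation of the uniformly ergodic chain, the centred (and reweighted) data
`W_{t+1} f(X_{t+1}) - ∫ f dμ` split into a bounded martingale increment and a telescoping
correction `H_t - H_{t+1}`. Absorbing the correction into the error `e_t = θ_t - θ_*`, a quadratic
Lyapunov function of the Hurwitz matrix `Ā` contracts by `1 - c α_t` per step up to a term of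
order `α_t ^ 2`, whence `E ‖e_t‖² = O(α_t)`.

Dividing the recursion by `α_t` and summing expresses `∑ (Ā e_i + W_{i+1} (A_{i+1} θ_* - b_{i+1}))`
through three terms: `∑ α_i⁻¹ (e_{i+1} - e_i)`, which is of order `α_t ^ (-1/2)` after summation by
parts; martingale increments that are linear in `e_i`, whose sum has second moment `O(∑ α_i)`; and
remainders of size `O(∑ α_i)`. Each is `o(√t)` in `L²` as soon as `η ∈ (1/2, 1)`, and
applying `Ā⁻¹` gives the representations.
-/

namespace LSA

section Poisson

variable {S F : Type*} [MeasurableSpace S] [NormedAddCommGroup F]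

lemma integrable_of_forall_norm_le {ν : Measure S} [IsFiniteMeasure ν] {f : S → F}
    (hf : StronglyMeasurable f) {K : ℝ} (hK : ∀ x, ‖f x‖ ≤ K) : Integrable f ν :=
  Integrable.of_bound hf.aestronglyMeasurable K (ae_of_all _ hK)

lemma abs_measureReal_sub_le_tvDist (p q : Measure S) [IsProbabilityMeasure p]
    [IsProbabilityMeasure q] {s : Set S} (hs : MeasurableSet s) :
    |p.real s - q.real s| ≤ tvDist p q := by
  refine le_ciSup (f := fun s : {s : Set S // MeasurableSet s} => |p.real s.1 - q.real s.1|)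
    ⟨1, ?_⟩ ⟨s, hs⟩
  rintro _ ⟨t, rfl⟩
  exact abs_sub_le_of_nonneg_of_le measureReal_nonneg measureReal_le_one measureReal_nonneg
    measureReal_le_one

variable [NormedSpace ℝ F]

lemma norm_integral_sub_le_of_le {p q : Measure S} [IsFiniteMeasure p] [IsFiniteMeasure q]
    (hle : p ≤ q) {f : S → F} (hf : StronglyMeasurable f) {K : ℝ} (hK : ∀ x, ‖f x‖ ≤ K) :
    ‖∫ x, f x ∂q - ∫ x, f x ∂p‖ ≤ K * (q.real Set.univ - p.real Set.univ) := by
  have hadd : q - p + p = q := Measure.sub_add_cancel_of_le hle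
  have hintegral : ∫ x, f x ∂q = ∫ x, f x ∂(q - p) + ∫ x, f x ∂p := by
    conv_lhs => rw [← hadd]
    exact integral_add_measure (integrable_of_forall_norm_le hf hK)
      (integrable_of_forall_norm_le hf hK)
  have hmass : q.real Set.univ = (q - p).real Set.univ + p.real Set.univ := by
    conv_lhs => rw [← hadd]
    exact measureReal_add_apply
  rw [hintegral, hmass, add_sub_cancel_right, add_sub_cancel_right]
  exact norm_integral_le_of_norm_le_const (ae_of_all _ hK)

lemma norm_integral_sub_le_tvDist (p q : Measure S) [IsProbabilityMeasure p]
    [IsProbabilityMeasure q] {f : S → F} (hf : StronglyMeasurable f) {K : ℝ}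
    (hK : ∀ x, ‖f x‖ ≤ K) :
    ‖∫ x, f x ∂p - ∫ x, f x ∂q‖ ≤ 2 * K * tvDist p q := by
  obtain ⟨s, hs⟩ := exists_isHahnDecomposition p q
  obtain ⟨x₀⟩ : Nonempty S := p.nonempty_of_neZero
  have hK0 : 0 ≤ K := (norm_nonneg _).trans (hK x₀)
  have hon := norm_integral_sub_le_of_le hs.le_on hf hK
  have hcompl := norm_integral_sub_le_of_le hs.ge_on_compl hf hK
  simp only [measureReal_restrict_apply_univ] at hon hcompl
  have htv := abs_le.1 (abs_measureReal_sub_le_tvDist p q hs.measurableSet)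
  have htv' := abs_le.1 (abs_measureReal_sub_le_tvDist p q hs.measurableSet.compl)
  rw [← integral_add_compl hs.measurableSet (integrable_of_forall_norm_le (ν := p) hf hK),
    ← integral_add_compl hs.measurableSet (integrable_of_forall_norm_le (ν := q) hf hK)]
  calc _ = ‖(∫ x in sᶜ, f x ∂p - ∫ x in sᶜ, f x ∂q) - (∫ x in s, f x ∂q - ∫ x in s, f x ∂p)‖ := by
        congr 1; abel
    _ ≤ K * (p.real sᶜ - q.real sᶜ) + K * (q.real s - p.real s) :=
        (norm_sub_le _ _).trans (add_le_add hcompl hon)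
    _ ≤ K * tvDist p q + K * tvDist p q := by gcongr <;> linarith
    _ = 2 * K * tvDist p q := by ring

instance isMarkovKernel_pow (κ : Kernel S S) [IsMarkovKernel κ] (n : ℕ) :
    IsMarkovKernel (κ ^ n) := by
  induction n with
  | zero => rw [pow_zero]; exact inferInstanceAs (IsMarkovKernel (Kernel.id : Kernel S S))
  | succ n ih => rw [pow_succ]; exact inferInstanceAs (IsMarkovKernel ((κ ^ n) ∘ₖ κ))

lemma invariant_pow {κ : Kernel S S} {μ : Measure S} (h : Kernel.Invariant κ μ) (n : ℕ) :
    Kernel.Invariant (κ ^ n) μ := by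
  induction n with
  | zero => rw [pow_zero]; exact Measure.id_comp
  | succ n ih => rw [pow_succ]; exact ih.comp h

lemma UniformlyErgodic.eventually_tvDist_le {κ : Kernel S S} {μ : Measure S}
    (hκ : UniformlyErgodic κ μ) {ε : ℝ} (hε : 0 < ε) :
    ∀ᶠ n in atTop, ∀ x, tvDist ((κ ^ n) x) μ ≤ ε := by
  filter_upwards [Metric.tendstoUniformly_iff.1 hκ.tendsto ε hε] with n hn x
  exact (le_abs_self _).trans (by simpa [dist_eq_norm] using (hn x).le)

lemma integral_kernel_pow_zero [CompleteSpace F] {κ : Kernel S S} {f : S → F}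
    (hf : StronglyMeasurable f) (x : S) : ∫ y, f y ∂(κ ^ 0) x = f x := by
  rw [pow_zero]
  exact integral_dirac' _ _ hf

variable {κ : Kernel S S} [IsMarkovKernel κ] {μ : Measure S} {f : S → F} {K : ℝ}

lemma norm_integral_kernel_le (hK : ∀ x, ‖f x‖ ≤ K) (x : S) : ‖∫ y, f y ∂κ x‖ ≤ K := by
  simpa using norm_integral_le_of_norm_le_const (μ := κ x) (ae_of_all _ hK)

lemma integral_kernel_pow_add (hf : StronglyMeasurable f) (hK : ∀ x, ‖f x‖ ≤ K) (m n : ℕ)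
    (x : S) : ∫ y, f y ∂(κ ^ (m + n)) x = ∫ y, ∫ z, f z ∂(κ ^ m) y ∂(κ ^ n) x := by
  rw [Kernel.pow_add]
  exact Kernel.integral_comp (integrable_of_forall_norm_le hf hK)

lemma integral_kernel_pow_succ (hf : StronglyMeasurable f) (hK : ∀ x, ‖f x‖ ≤ K) (n : ℕ)
    (x : S) : ∫ y, ∫ z, f z ∂(κ ^ n) y ∂κ x = ∫ y, f y ∂(κ ^ (n + 1)) x := by
  rw [integral_kernel_pow_add hf hK, pow_one]

lemma integral_bind_kernel [IsFiniteMeasure μ] (hf : StronglyMeasurable f)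
    (hK : ∀ x, ‖f x‖ ≤ K) : ∫ x, f x ∂(μ.bind κ) = ∫ x, ∫ y, f y ∂κ x ∂μ := by
  have h := Kernel.integral_comp (κ := Kernel.const Unit μ) (η := κ) (a := ()) (f := f)
    (integrable_of_forall_norm_le hf hK)
  rwa [← Measure.comp_eq_comp_const_apply] at h

/-- `g` is a strongly measurable solution, bounded by `C`, of the Poisson equation
`g - κ g = f - ∫ f dμ` for the kernel `κ` with stationary distribution `μ`. -/
structure IsBoundedPoissonSolution (κ : Kernel S S) (μ : Measure S) (f g : S → F) (C : ℝ) :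
    Prop where
  stronglyMeasurable : StronglyMeasurable g
  norm_le : ∀ x, ‖g x‖ ≤ C
  sub_eq : ∀ x, f x - ∫ y, f y ∂μ = g x - ∫ y, g y ∂κ x

lemma norm_integral_kernel_pow_sub_le [IsProbabilityMeasure μ] (hμ : Kernel.Invariant κ μ) {r : ℝ}
    (hr : ∀ x, tvDist (κ x) μ ≤ r) (n : ℕ) (hf : StronglyMeasurable f) (hK : ∀ x, ‖f x‖ ≤ K)
    (hzero : ∫ x, f x ∂μ = 0) (x : S) : ‖∫ y, f y ∂(κ ^ n) x‖ ≤ K * (2 * r) ^ n := by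
  induction n generalizing f K with
  | zero =>
    rw [pow_zero (2 * r), mul_one]
    exact norm_integral_kernel_le hK x
  | succ n ih =>
    have hK0 : 0 ≤ K := (norm_nonneg _).trans (hK x)
    have hmean : ∫ x, ∫ y, f y ∂κ x ∂μ = 0 := by
      rw [← integral_bind_kernel hf hK, hμ.def, hzero]
    have hcontract (y : S) : ‖∫ z, f z ∂κ y‖ ≤ K * (2 * r) := by
      have h := norm_integral_sub_le_tvDist (κ y) μ hf hK
      rw [hzero, sub_zero] at h
      calc ‖∫ z, f z ∂κ y‖ ≤ 2 * K * tvDist (κ y) μ := h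
        _ ≤ 2 * K * r := by gcongr; exact hr y
        _ = K * (2 * r) := by ring
    rw [add_comm n 1, integral_kernel_pow_add hf hK, pow_one, pow_add, pow_one, ← mul_assoc]
    exact ih hf.integral_kernel hcontract hmean

lemma isBoundedPoissonSolution_tsum [CompleteSpace F] (hf : StronglyMeasurable f)
    (hzero : ∫ x, f x ∂μ = 0) {u : ℕ → ℝ} (hu : Summable u)
    (hfu : ∀ n x, ‖∫ y, f y ∂(κ ^ n) x‖ ≤ u n) :
    IsBoundedPoissonSolution κ μ f (fun x => ∑' n, ∫ y, f y ∂(κ ^ n) x) (∑' n, u n) where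
  stronglyMeasurable := by
    refine stronglyMeasurable_of_tendsto atTop
      (f := fun N x => ∑ n ∈ Finset.range N, ∫ y, f y ∂(κ ^ n) x)
      (fun N => Finset.stronglyMeasurable_fun_sum _ fun n _ => hf.integral_kernel) ?_
    exact tendsto_pi_nhds.2 fun x =>
      (Summable.of_norm_bounded hu fun n => hfu n x).hasSum.tendsto_sum_nat
  norm_le x := tsum_of_norm_bounded hu.hasSum fun n => hfu n x
  sub_eq x := by
    have hbound (y : S) : ‖f y‖ ≤ u 0 := by
      simpa only [integral_kernel_pow_zero hf] using hfu 0 y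
    have hint (n : ℕ) : Integrable (fun y => ∫ z, f z ∂(κ ^ n) y) (κ x) :=
      integrable_of_forall_norm_le hf.integral_kernel (hfu n)
    have hsummable : Summable fun n => ∫ y, ‖∫ z, f z ∂(κ ^ n) y‖ ∂κ x :=
      Summable.of_norm_bounded hu fun n =>
        norm_integral_kernel_le (κ := κ) (fun y => by simpa using hfu n y) x
    have hshift : ∫ y, ∑' n, ∫ z, f z ∂(κ ^ n) y ∂κ x = ∑' n, ∫ y, f y ∂(κ ^ (n + 1)) x := by
      rw [← integral_tsum_of_summable_integral_norm hint hsummable]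
      simp_rw [integral_kernel_pow_succ hf hbound]
    rw [hzero, sub_zero, hshift,
      (Summable.of_norm_bounded hu fun n => hfu n x).tsum_eq_zero_add,
      integral_kernel_pow_zero hf, add_sub_cancel_right]

lemma IsBoundedPoissonSolution.sum_range_of_pow [CompleteSpace F] {n : ℕ} {g : S → F} {C : ℝ}
    (hg : IsBoundedPoissonSolution (κ ^ n) μ f g C) :
    IsBoundedPoissonSolution κ μ f (fun x => ∑ j ∈ Finset.range n, ∫ y, g y ∂(κ ^ j) x)
      (n * C) where
  stronglyMeasurable := Finset.stronglyMeasurable_fun_sum _ fun _ _ =>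
    hg.stronglyMeasurable.integral_kernel
  norm_le x := by
    simpa using norm_sum_le_of_le (Finset.range n) fun j _ =>
      norm_integral_kernel_le (κ := κ ^ j) hg.norm_le x
  sub_eq x := by
    have hint (j : ℕ) : Integrable (fun y => ∫ z, g z ∂(κ ^ j) y) (κ x) :=
      integrable_of_forall_norm_le hg.stronglyMeasurable.integral_kernel
        (norm_integral_kernel_le hg.norm_le)
    rw [integral_finsetSum _ fun j _ => hint j, ← Finset.sum_sub_distrib]
    simp_rw [integral_kernel_pow_succ hg.stronglyMeasurable hg.norm_le]
    rw [Finset.sum_range_sub', integral_kernel_pow_zero hg.stronglyMeasurable, hg.sub_eq]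

lemma exists_isBoundedPoissonSolution_of_tvDist_le [CompleteSpace F] [IsProbabilityMeasure μ]
    (hμ : Kernel.Invariant κ μ) {r : ℝ} (hr : ∀ x, tvDist (κ x) μ ≤ r) (hr2 : r < 1 / 2)
    (hf : StronglyMeasurable f) (hK : ∀ x, ‖f x‖ ≤ K) :
    ∃ (g : S → F) (C : ℝ), IsBoundedPoissonSolution κ μ f g C := by
  set c := ∫ y, f y ∂μ
  have hcentered : StronglyMeasurable fun x => f x - c := hf.sub stronglyMeasurable_const
  have hbound (x : S) : ‖f x - c‖ ≤ K + ‖c‖ := (norm_sub_le _ _).trans (by gcongr; exact hK x)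
  have hzero : ∫ x, (f x - c) ∂μ = 0 := by
    rw [integral_sub (integrable_of_forall_norm_le hf hK) (integrable_const _)]
    simp [c]
  obtain ⟨x₀⟩ : Nonempty S := μ.nonempty_of_neZero
  have hr0 : 0 ≤ r := ((abs_nonneg _).trans
    (abs_measureReal_sub_le_tvDist (κ x₀) μ .empty)).trans (hr x₀)
  have hgeom : Summable fun n : ℕ => (K + ‖c‖) * (2 * r) ^ n :=
    (summable_geometric_of_lt_one (by linarith) (by linarith)).mul_left _
  have hg := isBoundedPoissonSolution_tsum hcentered hzero hgeom fun n =>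
    norm_integral_kernel_pow_sub_le hμ hr n hcentered hbound hzero
  exact ⟨_, _, hg.stronglyMeasurable, hg.norm_le, fun x => by simpa [hzero] using hg.sub_eq x⟩

theorem UniformlyErgodic.exists_isBoundedPoissonSolution [CompleteSpace F]
    [IsProbabilityMeasure μ] (hκ : UniformlyErgodic κ μ) (hf : StronglyMeasurable f)
    (hK : ∀ x, ‖f x‖ ≤ K) : ∃ (g : S → F) (C : ℝ), IsBoundedPoissonSolution κ μ f g C := by
  obtain ⟨n, hn⟩ := (hκ.eventually_tvDist_le (ε := 1 / 4) (by norm_num)).exists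
  obtain ⟨g, C, hg⟩ := exists_isBoundedPoissonSolution_of_tvDist_le
    (invariant_pow hκ.invariant n) hn (by norm_num) hf hK
  exact ⟨_, _, hg.sum_range_of_pow⟩

lemma UniformlyErgodic.tendsto_integral_bind [CompleteSpace F] [IsProbabilityMeasure μ]
    (hκ : UniformlyErgodic κ μ) (ν : Measure S) [IsProbabilityMeasure ν] (hf : StronglyMeasurable f)
    (hK : ∀ x, ‖f x‖ ≤ K) :
    Tendsto (fun n : ℕ => ∫ x, f x ∂(ν.bind ⇑(κ ^ n))) atTop (𝓝 (∫ x, f x ∂μ)) := by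
  obtain ⟨x₀⟩ : Nonempty S := μ.nonempty_of_neZero
  have hK0 : 0 ≤ K := (norm_nonneg _).trans (hK x₀)
  refine Metric.tendsto_atTop.2 fun ε hε => eventually_atTop.1 ?_
  filter_upwards [hκ.eventually_tvDist_le (ε := ε / (2 * (K + 1))) (by positivity)] with n hn
  have hdiff (x : S) : ‖∫ y, f y ∂(κ ^ n) x - ∫ y, f y ∂μ‖ ≤ 2 * K * (ε / (2 * (K + 1))) :=
    (norm_integral_sub_le_tvDist _ μ hf hK).trans (by gcongr; exact hn x)
  have hint : Integrable (fun x => ∫ y, f y ∂(κ ^ n) x) ν :=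
    integrable_of_forall_norm_le hf.integral_kernel (norm_integral_kernel_le hK)
  calc dist (∫ x, f x ∂(ν.bind ⇑(κ ^ n))) (∫ x, f x ∂μ)
      = ‖∫ x, (∫ y, f y ∂(κ ^ n) x - ∫ y, f y ∂μ) ∂ν‖ := by
        rw [dist_eq_norm, integral_bind_kernel hf hK, integral_sub hint (integrable_const _)]
        simp
    _ ≤ 2 * K * (ε / (2 * (K + 1))) := by
        simpa using norm_integral_le_of_norm_le_const (μ := ν) (ae_of_all _ hdiff)
    _ < ε := by
        rw [mul_div_assoc', div_lt_iff₀ (by positivity)]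
        nlinarith

end Poisson

section Conditioning

variable {Ω F G : Type*} {mΩ : MeasurableSpace Ω} {P : Measure Ω} [IsFiniteMeasure P]
  [NormedAddCommGroup F] [NormedSpace ℝ F] [CompleteSpace F]
  [NormedAddCommGroup G] [NormedSpace ℝ G] [CompleteSpace G]

lemma integral_clm_apply_eq_zero_of_condExp_eq_zero {m : MeasurableSpace Ω} (hm : m ≤ mΩ)
    {D : Ω → F} (hD : Integrable D P) (hzero : P[D | m] =ᵐ[P] 0) {ψ : Ω → F →L[ℝ] G}
    (hψ : StronglyMeasurable[m] ψ) (hψD : Integrable (fun ω => ψ ω (D ω)) P) :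
    ∫ ω, ψ ω (D ω) ∂P = 0 := by
  rw [← integral_condExp hm]
  refine integral_eq_zero_of_ae ?_
  filter_upwards [hzero, condExp_bilin_of_stronglyMeasurable_left
    (ContinuousLinearMap.id ℝ (F →L[ℝ] G)) hψ hψD hD] with ω hω hpull
  exact hpull.trans (by simp [hω])

lemma sup_eq_generateFrom_image2_inter (m₁ m₂ : MeasurableSpace Ω) :
    m₁ ⊔ m₂ = MeasurableSpace.generateFrom
      (Set.image2 (· ∩ ·) {a | MeasurableSet[m₁] a} {b | MeasurableSet[m₂] b}) := by
  apply le_antisymm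
  · refine sup_le (fun a ha => ?_) (fun b hb => ?_)
    · exact MeasurableSpace.measurableSet_generateFrom ⟨a, ha, Set.univ, .univ, by simp⟩
    · exact MeasurableSpace.measurableSet_generateFrom ⟨Set.univ, .univ, b, hb, by simp⟩
  · refine MeasurableSpace.generateFrom_le ?_
    rintro _ ⟨a, ha, b, hb, rfl⟩
    exact MeasurableSet.inter ((le_sup_left : m₁ ≤ m₁ ⊔ m₂) _ ha)
      ((le_sup_right : m₂ ≤ m₁ ⊔ m₂) _ hb)

lemma isPiSystem_image2_inter (m₁ m₂ : MeasurableSpace Ω) :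
    IsPiSystem (Set.image2 (· ∩ ·) {a | MeasurableSet[m₁] a} {b | MeasurableSet[m₂] b}) := by
  rintro _ ⟨a, ha, b, hb, rfl⟩ _ ⟨a', ha', b', hb', rfl⟩ _
  exact ⟨a ∩ a', MeasurableSet.inter ha ha', b ∩ b', MeasurableSet.inter hb hb',
    (Set.inter_inter_inter_comm a b a' b').symm⟩

lemma setIntegral_inter_of_indep {m₁ m₂ : MeasurableSpace Ω} (hm₁ : m₁ ≤ mΩ) (hm₂ : m₂ ≤ mΩ)
    (hindep : Indep m₁ m₂ P) {D : Ω → F} (hD : StronglyMeasurable[m₁] D) (hDi : Integrable D P)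
    {a b : Set Ω} (ha : MeasurableSet[m₁] a) (hb : MeasurableSet[m₂] b) :
    ∫ ω in a ∩ b, D ω ∂P = P.real b • ∫ ω in a, D ω ∂P := by
  have hcond : P[a.indicator D | m₂] =ᵐ[P] fun _ => ∫ ω, a.indicator D ω ∂P :=
    condExp_indep_eq hm₁ hm₂ (hD.indicator ha) hindep
  rw [Set.inter_comm, ← setIntegral_indicator (hm₁ _ ha),
    ← setIntegral_condExp hm₂ (hDi.indicator (hm₁ _ ha)) hb,
    setIntegral_congr_ae (hm₂ _ hb) (hcond.mono fun ω hω _ => hω), setIntegral_const,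
    integral_indicator (hm₁ _ ha)]

lemma condExp_sup_of_indep {m₁ n₁ m₂ : MeasurableSpace Ω} (hmn : m₁ ≤ n₁) (hn₁ : n₁ ≤ mΩ)
    (hm₂ : m₂ ≤ mΩ) (hindep : Indep n₁ m₂ P) {D : Ω → F} (hD : StronglyMeasurable[n₁] D)
    (hDi : Integrable D P) : P[D | m₁ ⊔ m₂] =ᵐ[P] P[D | m₁] := by
  have hm₁ : m₁ ≤ mΩ := hmn.trans hn₁
  have hsup : m₁ ⊔ m₂ ≤ mΩ := sup_le hm₁ hm₂
  suffices h : ∀ s, MeasurableSet[m₁ ⊔ m₂] s → ∫ ω in s, (P[D | m₁]) ω ∂P = ∫ ω in s, D ω ∂P from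
    (ae_eq_condExp_of_forall_setIntegral_eq hsup hDi
      (fun _ _ _ => integrable_condExp.integrableOn) (fun s hs _ => h s hs)
      (stronglyMeasurable_condExp.mono le_sup_left).aestronglyMeasurable).symm
  intro s hs
  induction s, hs using MeasurableSpace.induction_on_inter
    (sup_eq_generateFrom_image2_inter m₁ m₂) (isPiSystem_image2_inter m₁ m₂) with
  | empty => simp
  | basic s hs =>
    obtain ⟨a, ha, b, hb, rfl⟩ := hs
    rw [setIntegral_inter_of_indep hn₁ hm₂ hindep (stronglyMeasurable_condExp.mono hmn)
        integrable_condExp (hmn _ ha) hb,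
      setIntegral_inter_of_indep hn₁ hm₂ hindep hD hDi (hmn _ ha) hb,
      setIntegral_condExp hm₁ hDi ha]
  | compl s hs ih =>
    rw [setIntegral_compl (hsup _ hs) integrable_condExp, setIntegral_compl (hsup _ hs) hDi, ih,
      integral_condExp hm₁]
  | iUnion s hdisj hs ih =>
    rw [integral_iUnion (fun i => hsup _ (hs i)) hdisj integrable_condExp.integrableOn,
      integral_iUnion (fun i => hsup _ (hs i)) hdisj hDi.integrableOn, tsum_congr ih]

end Conditioning

section Histories

variable {Ω S : Type*} {mΩ : MeasurableSpace Ω} [MeasurableSpace S]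

lemma history_le {X : ℕ → Ω → S} (hX : ∀ t, 1 ≤ t → Measurable (X t)) (t : ℕ) :
    history X t ≤ mΩ :=
  iSup₂_le fun i hi => (hX i (Finset.mem_Icc.1 hi).1).comap_le

lemma history_mono (X : ℕ → Ω → S) : Monotone (history X) := fun _ _ hst =>
  biSup_mono fun _ hi => Finset.Icc_subset_Icc_right hst hi

lemma measurable_history (X : ℕ → Ω → S) {t : ℕ} (ht : 1 ≤ t) : Measurable[history X t] (X t) :=
  measurable_iff_comap_le.2 <| le_iSup₂_of_le (f := fun i (_ : i ∈ Finset.Icc 1 t) =>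
    MeasurableSpace.comap (X i) inferInstance) t (Finset.mem_Icc.2 ⟨ht, le_rfl⟩) le_rfl

/-- The σ-algebra `σ(X_1, X_2, …)`. -/
abbrev fullHistory (X : ℕ → Ω → S) : MeasurableSpace Ω :=
  MeasurableSpace.comap (fun ω (t : ℕ) => X (t + 1) ω) inferInstance

lemma measurable_fullHistory (X : ℕ → Ω → S) {t : ℕ} (ht : 1 ≤ t) :
    Measurable[fullHistory X] (X t) := by
  obtain ⟨s, rfl⟩ := Nat.exists_eq_add_of_le' ht
  exact (measurable_pi_apply s).comp (comap_measurable fun ω (t : ℕ) => X (t + 1) ω)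

lemma history_le_fullHistory (X : ℕ → Ω → S) (t : ℕ) : history X t ≤ fullHistory X :=
  iSup₂_le fun _ hi => (measurable_fullHistory X (Finset.mem_Icc.1 hi).1).comap_le

lemma fullHistory_le {X : ℕ → Ω → S} (hX : ∀ t, 1 ≤ t → Measurable (X t)) :
    fullHistory X ≤ mΩ :=
  (measurable_pi_lambda _ fun t => hX (t + 1) (by omega)).comap_le

/-- The filtration `𝓕 n = σ(X_1, …, X_{n+1}, W_1, …, W_{n+1})`. Time is shifted by one because the
average in the theorem starts at `θ_1`, the iterate known at time `n = 0` of this filtration. -/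
def jointFiltration {X : ℕ → Ω → S} {W : ℕ → Ω → ℝ} (hX : ∀ t, 1 ≤ t → Measurable (X t))
    (hW : ∀ t, 1 ≤ t → Measurable (W t)) : Filtration ℕ mΩ where
  seq n := history X (n + 1) ⊔ history W (n + 1)
  mono' _ _ hmn := sup_le_sup (history_mono X (by omega)) (history_mono W (by omega))
  le' n := sup_le (history_le hX (n + 1)) (history_le hW (n + 1))

variable {X : ℕ → Ω → S} {W : ℕ → Ω → ℝ} (hX : ∀ t, 1 ≤ t → Measurable (X t))
  (hW : ∀ t, 1 ≤ t → Measurable (W t))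

lemma measurable_jointFiltration_left (n : ℕ) :
    Measurable[jointFiltration hX hW n] (X (n + 1)) :=
  (measurable_history X (by omega)).mono le_sup_left le_rfl

lemma measurable_jointFiltration_right (n : ℕ) :
    Measurable[jointFiltration hX hW n] (W (n + 1)) :=
  (measurable_history W (by omega)).mono le_sup_right le_rfl

end Histories

section Chain

variable {Ω S F : Type*} {mΩ : MeasurableSpace Ω} [MeasurableSpace S] {P : Measure Ω}
  [IsProbabilityMeasure P] {κ : Kernel S S} {X : ℕ → Ω → S}

lemma IsMarkovChain.measureReal_preimage_inter (hX : IsMarkovChain P κ X) {t : ℕ} (ht : 1 ≤ t)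
    {a : Set Ω} (ha : MeasurableSet[history X t] a) {B : Set S} (hB : MeasurableSet B) :
    P.real (X (t + 1) ⁻¹' B ∩ a) = ∫ ω in a, (κ (X t ω)).real B ∂P := by
  have hle := history_le hX.measurable t
  have hpre : MeasurableSet (X (t + 1) ⁻¹' B) := hX.measurable (t + 1) (by omega) hB
  rw [← setIntegral_congr_ae (hle _ ha) ((hX.markov t ht B hB).mono fun ω h _ => h),
    setIntegral_condExp hle ((integrable_const _).indicator hpre) ha,
    integral_indicator_const _ hpre]
  simp [measureReal_restrict_apply hpre]

variable [IsMarkovKernel κ]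

lemma IsMarkovChain.map_restrict (hX : IsMarkovChain P κ X) {t : ℕ} (ht : 1 ≤ t) {a : Set Ω}
    (ha : MeasurableSet[history X t] a) :
    (P.restrict a).map (X (t + 1)) = ((P.restrict a).map (X t)).bind κ := by
  have hXt := hX.measurable t ht
  have hXs := hX.measurable (t + 1) (by omega)
  ext B hB
  have hκB : Measurable fun x => κ x B := κ.measurable_coe hB
  rw [Measure.map_apply hXs hB, Measure.bind_apply hB κ.aemeasurable, lintegral_map hκB hXt,
    Measure.restrict_apply (hXs hB), ← ofReal_measureReal, hX.measureReal_preimage_inter ht ha hB]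
  have hreal : ∫ ω in a, (κ (X t ω)).real B ∂P = (∫⁻ ω in a, κ (X t ω) B ∂P).toReal :=
    integral_toReal (hκB.comp hXt).aemeasurable (ae_of_all _ fun _ => measure_lt_top _ _)
  have hfin : ∫⁻ ω in a, κ (X t ω) B ∂P ≠ ⊤ :=
    ne_top_of_le_ne_top (b := ∫⁻ _ in a, 1 ∂P) (by simp) (lintegral_mono fun _ => prob_le_one)
  rw [hreal, ENNReal.ofReal_toReal hfin]

lemma IsMarkovChain.map_add (hX : IsMarkovChain P κ X) (n : ℕ) :
    P.map (X (n + 1)) = (P.map (X 1)).bind ⇑(κ ^ n) := by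
  induction n with
  | zero => rw [pow_zero]; exact (Measure.id_comp (μ := P.map (X 1))).symm
  | succ n ih =>
    have hstep := hX.map_restrict (t := n + 1) (by omega) MeasurableSet.univ
    rw [Measure.restrict_univ, ih] at hstep
    rw [hstep, pow_succ']
    exact Measure.comp_assoc

variable [NormedAddCommGroup F] [NormedSpace ℝ F] [CompleteSpace F]

lemma IsMarkovChain.condExp_comp (hX : IsMarkovChain P κ X) {g : S → F} (hg : StronglyMeasurable g)
    {C : ℝ} (hC : ∀ x, ‖g x‖ ≤ C) {t : ℕ} (ht : 1 ≤ t) :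
    P[fun ω => g (X (t + 1) ω) | history X t] =ᵐ[P] fun ω => ∫ y, g y ∂κ (X t ω) := by
  have hle := history_le hX.measurable t
  have hXt := hX.measurable t ht
  have hXs := hX.measurable (t + 1) (by omega)
  have hκg : StronglyMeasurable fun x => ∫ y, g y ∂κ x := hg.integral_kernel
  refine (ae_eq_condExp_of_forall_setIntegral_eq hle
    (integrable_of_forall_norm_le (hg.comp_measurable hXs) fun _ => hC _)
    (fun _ _ _ => (integrable_of_forall_norm_le (hκg.comp_measurable hXt) fun _ =>
      norm_integral_kernel_le hC _).integrableOn) (fun a ha _ => ?_)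
    (hκg.comp_measurable (measurable_history X ht)).aestronglyMeasurable).symm
  change ∫ ω in a, ∫ y, g y ∂κ (X t ω) ∂P = ∫ ω in a, g (X (t + 1) ω) ∂P
  rw [← integral_map hXt.aemeasurable hκg.aestronglyMeasurable,
    ← integral_map hXs.aemeasurable hg.aestronglyMeasurable, hX.map_restrict ht ha,
    integral_bind_kernel hg hC]

lemma IsMarkovChain.tendsto_integral (hX : IsMarkovChain P κ X) {μ : Measure S}
    [IsProbabilityMeasure μ] (hκ : UniformlyErgodic κ μ) {f : S → F} (hf : StronglyMeasurable f)
    {K : ℝ} (hK : ∀ x, ‖f x‖ ≤ K) :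
    Tendsto (fun t : ℕ => ∫ ω, f (X t ω) ∂P) atTop (𝓝 (∫ x, f x ∂μ)) := by
  have hX1 := hX.measurable 1 le_rfl
  have : IsProbabilityMeasure (P.map (X 1)) := Measure.isProbabilityMeasure_map hX1.aemeasurable
  rw [← tendsto_add_atTop_iff_nat 1]
  refine (hκ.tendsto_integral_bind (P.map (X 1)) hf hK).congr fun n => ?_
  rw [← hX.map_add, integral_map (hX.measurable (n + 1) (by omega)).aemeasurable
    hf.aestronglyMeasurable]

end Chain

section Weights

variable {Ω S : Type*} {mΩ : MeasurableSpace Ω} [MeasurableSpace S]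

/-- Bounded weights `(W_t)_{t ≥ 1}`, independent of the chain, with conditional mean one given the
past weights. Both the bootstrap weights and the constant weights `1` are of this kind. -/
structure IsMeanOneWeights (P : Measure Ω) (X : ℕ → Ω → S) (W : ℕ → Ω → ℝ) : Prop where
  measurable : ∀ t, 1 ≤ t → Measurable (W t)
  bounded : ∃ B : ℝ, ∀ t, 1 ≤ t → ∀ᵐ ω ∂P, |W t ω| ≤ B
  indep_chain : IndepFun (fun ω (t : ℕ) => X (t + 1) ω) (fun ω (t : ℕ) => W (t + 1) ω) P
  condExp_eq_one : ∀ t, 1 ≤ t → P[W (t + 1) | history W t] =ᵐ[P] fun _ => 1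

variable {P : Measure Ω} {X : ℕ → Ω → S} {W : ℕ → Ω → ℝ}

lemma IsBootstrapWeights.indep_history (hW : IsBootstrapWeights P X W) (t : ℕ) :
    Indep (MeasurableSpace.comap (W (t + 1)) inferInstance) (history W t) P := by
  have hsup := indep_iSup_of_disjoint
    (fun i => (hW.measurable (i + 1) (by omega)).comap_le) hW.indep
    (S := {t}) (T := {i | i < t}) (by simp)
  rw [iSup_singleton] at hsup
  refine indep_of_indep_of_le_right hsup (iSup₂_le fun i hi => ?_)
  obtain ⟨j, rfl⟩ := Nat.exists_eq_add_of_le' (Finset.mem_Icc.1 hi).1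
  exact le_iSup₂_of_le (f := fun i (_ : i ∈ {i | i < t}) =>
    MeasurableSpace.comap (W (i + 1)) inferInstance) j (Finset.mem_Icc.1 hi).2 le_rfl

variable [IsProbabilityMeasure P]

lemma isMeanOneWeights_one : IsMeanOneWeights P X (fun _ _ => 1) where
  measurable _ _ := measurable_const
  bounded := ⟨1, fun _ _ => by simp⟩
  indep_chain := indepFun_const_right _ _
  condExp_eq_one t _ := by rw [condExp_const (history_le (fun _ _ => measurable_const) t)]

lemma IsBootstrapWeights.isMeanOneWeights (hW : IsBootstrapWeights P X W) :
    IsMeanOneWeights P X W where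
  measurable := hW.measurable
  bounded := by
    obtain ⟨B, hB⟩ := hW.bounded
    exact ⟨B, fun t ht => (hW.identDistrib t ht).symm.ae_mem_snd (t := {x | |x| ≤ B})
      (measurableSet_le measurable_norm measurable_const) hB⟩
  indep_chain := hW.indep_chain
  condExp_eq_one t _ := by
    have hcond := condExp_indep_eq (f := W (t + 1)) (hW.measurable (t + 1) (by omega)).comap_le
      (history_le hW.measurable t) (comap_measurable (W (t + 1))).stronglyMeasurable
      (hW.indep_history t)
    rwa [(hW.identDistrib (t + 1) (by omega)).integral_eq, hW.mean] at hcond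

end Weights

section Noise

variable {Ω S F : Type*} {mΩ : MeasurableSpace Ω} [MeasurableSpace S] [NormedAddCommGroup F]
  [NormedSpace ℝ F]

/-- Martingale differences `M n` (the increment from time `n` to time `n + 1`) and an adapted
corrector `H`, both bounded by `C`. This is what the observations along the chain look like after
subtracting their mean: they differ from it by `M n + (H n - H (n + 1))`. -/
structure IsBoundedNoise (P : Measure Ω) (𝓕 : Filtration ℕ mΩ) (C : ℝ) (M H : ℕ → Ω → F) :
    Prop where
  stronglyMeasurable_incr : ∀ n, StronglyMeasurable[𝓕 (n + 1)] (M n)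
  stronglyAdapted_corr : StronglyAdapted 𝓕 H
  norm_incr_le : ∀ n, ∀ᵐ ω ∂P, ‖M n ω‖ ≤ C
  norm_corr_le : ∀ n, ∀ᵐ ω ∂P, ‖H n ω‖ ≤ C
  condExp_incr : ∀ n, P[M n | 𝓕 n] =ᵐ[P] 0

/-- The corrector `(κ g)(X_{n+1})` of the Poisson solution `g`. -/
noncomputable def noiseCorrector (κ : Kernel S S) (X : ℕ → Ω → S) (g : S → F) (n : ℕ) (ω : Ω) : F :=
  ∫ y, g y ∂κ (X (n + 1) ω)

/-- The martingale difference carried by the weighted observation `W_{n+2} f(X_{n+2})`: a part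
coming from the weight and a part coming from the chain through the Poisson solution `g`. -/
noncomputable def noiseIncrement (κ : Kernel S S) (X : ℕ → Ω → S) (W : ℕ → Ω → ℝ) (f g : S → F)
    (n : ℕ) (ω : Ω) : F :=
  (W (n + 2) ω - 1) • f (X (n + 2) ω) + (g (X (n + 2) ω) - noiseCorrector κ X g n ω)

variable {P : Measure Ω} {κ : Kernel S S} {μ : Measure S} {X : ℕ → Ω → S} {W : ℕ → Ω → ℝ}
  {f g : S → F} {K C : ℝ}

lemma IsBoundedPoissonSolution.smul_eq_integral_add_noise (hg : IsBoundedPoissonSolution κ μ f g C)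
    (n : ℕ) (ω : Ω) :
    W (n + 2) ω • f (X (n + 2) ω) = ∫ x, f x ∂μ + noiseIncrement κ X W f g n ω
      + (noiseCorrector κ X g n ω - noiseCorrector κ X g (n + 1) ω) := by
  have hpoisson := hg.sub_eq (X (n + 2) ω)
  rw [sub_eq_iff_eq_add] at hpoisson
  calc W (n + 2) ω • f (X (n + 2) ω)
      = (W (n + 2) ω - 1) • f (X (n + 2) ω) + f (X (n + 2) ω) := by
        rw [sub_smul, one_smul, sub_add_cancel]
    _ = _ := by rw [noiseIncrement, noiseCorrector, noiseCorrector, hpoisson]; abel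

lemma stronglyMeasurable_noiseCorrector {m : MeasurableSpace Ω} {n : ℕ}
    (hX : Measurable[m] (X (n + 1))) (hg : StronglyMeasurable g) :
    StronglyMeasurable[m] (noiseCorrector κ X g n) :=
  hg.integral_kernel.comp_measurable hX

variable [IsProbabilityMeasure P] [IsMarkovKernel κ]

lemma norm_noiseCorrector_le (hC : ∀ x, ‖g x‖ ≤ C) (n : ℕ) (ω : Ω) :
    ‖noiseCorrector κ X g n ω‖ ≤ C :=
  norm_integral_kernel_le hC _

lemma norm_noiseIncrement_le (hK : ∀ x, ‖f x‖ ≤ K) (hC : ∀ x, ‖g x‖ ≤ C) {B : ℝ} {n : ℕ} {ω : Ω}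
    (hB : |W (n + 2) ω| ≤ B) : ‖noiseIncrement κ X W f g n ω‖ ≤ (B + 1) * K + 2 * C := by
  have hweight : ‖(W (n + 2) ω - 1) • f (X (n + 2) ω)‖ ≤ (B + 1) * K := by
    rw [norm_smul]
    have hB0 : 0 ≤ B := (abs_nonneg _).trans hB
    gcongr
    · exact (norm_sub_le _ _).trans (by simpa using hB)
    · exact hK _
  have hchain : ‖g (X (n + 2) ω) - noiseCorrector κ X g n ω‖ ≤ C + C :=
    norm_sub_le_of_le (hC _) (norm_noiseCorrector_le hC n ω)
  exact (norm_add_le_of_le hweight hchain).trans_eq (by ring)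

variable [CompleteSpace F]

lemma IsMarkovChain.condExp_sub_noiseCorrector (hX : IsMarkovChain P κ X)
    (hW : IsMeanOneWeights P X W) (hg : StronglyMeasurable g) (hC : ∀ x, ‖g x‖ ≤ C) (n : ℕ) :
    P[fun ω => g (X (n + 2) ω) - noiseCorrector κ X g n ω |
      jointFiltration hX.measurable hW.measurable n] =ᵐ[P] 0 := by
  have hXle := fullHistory_le hX.measurable
  have hgX : StronglyMeasurable[fullHistory X] fun ω => g (X (n + 2) ω) :=
    hg.comp_measurable (measurable_fullHistory X (by omega))
  have hcorr : StronglyMeasurable[history X (n + 1)] (noiseCorrector κ X g n) :=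
    stronglyMeasurable_noiseCorrector (measurable_history X (by omega)) hg
  have hgXi : Integrable (fun ω => g (X (n + 2) ω)) P :=
    integrable_of_forall_norm_le (hgX.mono hXle) fun _ => hC _
  have hcorri : Integrable (noiseCorrector κ X g n) P :=
    integrable_of_forall_norm_le (hcorr.mono (history_le hX.measurable _))
      (norm_noiseCorrector_le hC n)
  have hpast : P[fun ω => g (X (n + 2) ω) - noiseCorrector κ X g n ω | history X (n + 1)]
      =ᵐ[P] 0 := by
    filter_upwards [condExp_sub hgXi hcorri (history X (n + 1)),
      hX.condExp_comp hg hC (t := n + 1) (by omega)] with ω hsub hmarkov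
    rw [condExp_of_stronglyMeasurable (history_le hX.measurable _) hcorr hcorri] at hsub
    exact hsub.trans (by rw [Pi.sub_apply, hmarkov]; exact sub_self _)
  exact (condExp_sup_of_indep (history_le_fullHistory X _) hXle (history_le hW.measurable _)
    (indep_of_indep_of_le_right hW.indep_chain (history_le_fullHistory W _))
    (hgX.sub (hcorr.mono (history_le_fullHistory X _))) (hgXi.sub hcorri)).trans hpast

lemma IsMeanOneWeights.integrable (hW : IsMeanOneWeights P X W) (n : ℕ) :
    Integrable (W (n + 1)) P := by
  obtain ⟨B, hB⟩ := hW.bounded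
  exact Integrable.of_bound (hW.measurable (n + 1) (by omega)).aestronglyMeasurable B
    (hB (n + 1) (by omega))

lemma IsMeanOneWeights.condExp_sub_one (hW : IsMeanOneWeights P X W)
    (hX : ∀ t, 1 ≤ t → Measurable (X t)) (n : ℕ) :
    P[fun ω => W (n + 2) ω - 1 | history W (n + 1) ⊔ fullHistory X] =ᵐ[P] 0 := by
  have hWle := history_le hW.measurable (n + 1)
  have hsup := condExp_sup_of_indep (history_le_fullHistory W (n + 1))
    (fullHistory_le hW.measurable) (fullHistory_le hX) (hW.indep_chain : Indep _ _ P).symm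
    ((measurable_fullHistory W (t := n + 2) (by omega)).sub_const 1).stronglyMeasurable
    ((hW.integrable (n + 1)).sub (integrable_const 1))
  filter_upwards [hsup, condExp_sub (hW.integrable (n + 1)) (integrable_const (1 : ℝ))
    (history W (n + 1)), hW.condExp_eq_one (n + 1) (by omega)] with ω hω hsub hone
  rw [condExp_const hWle] at hsub
  exact hω.trans (hsub.trans (by rw [Pi.sub_apply, hone]; exact sub_self _))

lemma IsMeanOneWeights.condExp_sub_one_smul (hW : IsMeanOneWeights P X W)
    (hX : ∀ t, 1 ≤ t → Measurable (X t)) (hf : StronglyMeasurable f) (hK : ∀ x, ‖f x‖ ≤ K)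
    (n : ℕ) :
    P[fun ω => (W (n + 2) ω - 1) • f (X (n + 2) ω) |
      jointFiltration hX hW.measurable n] =ᵐ[P] 0 := by
  have hle : history W (n + 1) ⊔ fullHistory X ≤ mΩ :=
    sup_le (history_le hW.measurable _) (fullHistory_le hX)
  have hmono : jointFiltration hX hW.measurable n ≤ history W (n + 1) ⊔ fullHistory X :=
    sup_le (le_sup_of_le_right (history_le_fullHistory X _)) le_sup_left
  have hfX : StronglyMeasurable[fullHistory X] fun ω => f (X (n + 2) ω) :=
    hf.comp_measurable (measurable_fullHistory X (by omega))
  have hWi : Integrable (fun ω => W (n + 2) ω - 1) P :=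
    (hW.integrable (n + 1)).sub (integrable_const 1)
  have hprod : Integrable (fun ω => (W (n + 2) ω - 1) • f (X (n + 2) ω)) P :=
    hWi.smul_bdd K (hfX.mono (fullHistory_le hX)).aestronglyMeasurable (ae_of_all _ fun _ => hK _)
  have hzero : P[fun ω => (W (n + 2) ω - 1) • f (X (n + 2) ω) |
      history W (n + 1) ⊔ fullHistory X] =ᵐ[P] 0 := by
    have hfXm : StronglyMeasurable[history W (n + 1) ⊔ fullHistory X] fun ω => f (X (n + 2) ω) :=
      hfX.mono le_sup_right
    filter_upwards [condExp_smul_of_aestronglyMeasurable_right hWi hprod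
      hfXm.aestronglyMeasurable, hW.condExp_sub_one hX n] with ω hpull hω
    exact hpull.trans (by simp [hω])
  exact (condExp_condExp_of_le hmono hle).symm.trans
    ((condExp_congr_ae hzero).trans (by rw [condExp_zero]))

lemma exists_isBoundedNoise (hX : IsMarkovChain P κ X) (hW : IsMeanOneWeights P X W)
    (hf : StronglyMeasurable f) (hK : ∀ x, ‖f x‖ ≤ K) (hg : StronglyMeasurable g)
    (hC : ∀ x, ‖g x‖ ≤ C) :
    ∃ C', IsBoundedNoise P (jointFiltration hX.measurable hW.measurable) C'
      (noiseIncrement κ X W f g) (noiseCorrector κ X g) := by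
  obtain ⟨B, hB⟩ := hW.bounded
  set 𝓕 := jointFiltration hX.measurable hW.measurable
  have hXF (n : ℕ) : Measurable[𝓕 n] (X (n + 1)) :=
    measurable_jointFiltration_left hX.measurable hW.measurable n
  have hcorr (n : ℕ) : StronglyMeasurable[𝓕 n] (noiseCorrector κ X g n) :=
    stronglyMeasurable_noiseCorrector (hXF n) hg
  have hweight (n : ℕ) :
      StronglyMeasurable[𝓕 (n + 1)] fun ω => (W (n + 2) ω - 1) • f (X (n + 2) ω) :=
    ((measurable_jointFiltration_right hX.measurable hW.measurable (n + 1)).sub_const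
      1).stronglyMeasurable.smul (hf.comp_measurable (hXF (n + 1)))
  have hchain (n : ℕ) :
      StronglyMeasurable[𝓕 (n + 1)] fun ω => g (X (n + 2) ω) - noiseCorrector κ X g n ω :=
    (hg.comp_measurable (hXF (n + 1))).sub ((hcorr n).mono (𝓕.mono n.le_succ))
  refine ⟨max C ((B + 1) * K + 2 * C), fun n => (hweight n).add (hchain n), hcorr, fun n => ?_,
    fun n => ae_of_all _ fun ω => (norm_noiseCorrector_le hC n ω).trans (le_max_left _ _),
    fun n => ?_⟩
  · exact (hB (n + 2) (by omega)).mono fun ω hω =>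
      (norm_noiseIncrement_le hK hC hω).trans (le_max_right _ _)
  · have hweighti : Integrable (fun ω => (W (n + 2) ω - 1) • f (X (n + 2) ω)) P :=
      ((hW.integrable (n + 1)).sub (integrable_const 1)).smul_bdd K
        (hf.comp_measurable (hX.measurable (n + 2) (by omega))).aestronglyMeasurable
        (ae_of_all _ fun _ => hK _)
    have hchaini : Integrable (fun ω => g (X (n + 2) ω) - noiseCorrector κ X g n ω) P :=
      integrable_of_forall_norm_le ((hchain n).mono (𝓕.le _)) fun ω =>
        norm_sub_le_of_le (hC _) (norm_noiseCorrector_le hC n ω)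
    filter_upwards [condExp_add hweighti hchaini (𝓕 n),
      hW.condExp_sub_one_smul hX.measurable hf hK n,
      hX.condExp_sub_noiseCorrector hW hg hC n] with ω hadd hω hω'
    exact hadd.trans (by rw [Pi.add_apply, hω, hω']; exact add_zero _)

theorem exists_noise_decomposition [IsProbabilityMeasure μ] (hκ : UniformlyErgodic κ μ)
    (hX : IsMarkovChain P κ X) (hW : IsMeanOneWeights P X W) (hf : StronglyMeasurable f)
    (hK : ∀ x, ‖f x‖ ≤ K) :
    ∃ (C : ℝ) (M H : ℕ → Ω → F),
      IsBoundedNoise P (jointFiltration hX.measurable hW.measurable) C M H ∧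
      ∀ n ω, W (n + 2) ω • f (X (n + 2) ω)
        = ∫ x, f x ∂μ + M n ω + (H n ω - H (n + 1) ω) := by
  obtain ⟨g, C, hg⟩ := hκ.exists_isBoundedPoissonSolution hf hK
  obtain ⟨C', hnoise⟩ := exists_isBoundedNoise hX hW hf hK hg.stronglyMeasurable hg.norm_le
  exact ⟨C', _, _, hnoise, hg.smul_eq_integral_add_noise⟩

end Noise

section Lyapunov

variable {E : Type*} [NormedAddCommGroup E] [InnerProductSpace ℝ E]

/-- `S` is a Lyapunov operator for `T`: the quadratic form `u ↦ ⟪S u, u⟫` dominates `‖u‖ ^ 2` and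
decreases at rate `c` along the flow of `T`. -/
structure IsLyapunov (T S : E →L[ℝ] E) (c : ℝ) : Prop where
  isSymmetric : (S : E →ₗ[ℝ] E).IsSymmetric
  sq_norm_le : ∀ u, ‖u‖ ^ 2 ≤ inner ℝ (S u) u
  pos : 0 < c
  inner_apply_le : ∀ u, inner ℝ (S u) (T u) ≤ -c * ‖u‖ ^ 2

lemma inner_apply_add_self {S : E →L[ℝ] E} (hS : (S : E →ₗ[ℝ] E).IsSymmetric) (u v : E) :
    inner ℝ (S (u + v)) (u + v)
      = inner ℝ (S u) u + 2 * inner ℝ (S u) v + inner ℝ (S v) v := by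
  have hvu : inner ℝ (S v) u = inner ℝ (S u) v := (hS v u).trans (real_inner_comm _ _)
  rw [map_add, inner_add_left, inner_add_right, inner_add_right, hvu]
  ring

variable [CompleteSpace E]

/-- The sum `∑ k < N, (B ^ k)† B ^ k`, which truncates the series solving the discrete Lyapunov
equation `S - B† S B = 1`. -/
noncomputable def gramSum (B : E →L[ℝ] E) (N : ℕ) : E →L[ℝ] E :=
  ∑ k ∈ Finset.range N, (B ^ k).adjoint ∘L (B ^ k)

variable (B : E →L[ℝ] E) (N : ℕ)

lemma inner_gramSum (u v : E) :
    inner ℝ (gramSum B N u) v = ∑ k ∈ Finset.range N, inner ℝ ((B ^ k) u) ((B ^ k) v) := by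
  simp [gramSum, sum_inner, ContinuousLinearMap.adjoint_inner_left]

lemma isSymmetric_gramSum : (gramSum B N : E →ₗ[ℝ] E).IsSymmetric := fun u v => by
  rw [ContinuousLinearMap.coe_coe, inner_gramSum, real_inner_comm, inner_gramSum]
  exact Finset.sum_congr rfl fun k _ => real_inner_comm _ _

lemma inner_gramSum_self (u : E) :
    inner ℝ (gramSum B N u) u = ∑ k ∈ Finset.range N, ‖(B ^ k) u‖ ^ 2 := by
  simp [inner_gramSum]

lemma inner_gramSum_apply_self (u : E) :
    inner ℝ (gramSum B N (B u)) (B u) = inner ℝ (gramSum B N u) u + ‖(B ^ N) u‖ ^ 2 - ‖u‖ ^ 2 := by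
  have hshift (k : ℕ) : (B ^ k) (B u) = (B ^ (k + 1)) u := by rw [pow_succ]; rfl
  have htop := Finset.sum_range_succ (fun k => ‖(B ^ k) u‖ ^ 2) N
  have hbottom := Finset.sum_range_succ' (fun k => ‖(B ^ k) u‖ ^ 2) N
  simp only [pow_zero, one_apply_eq_self] at hbottom
  simp only [inner_gramSum_self, hshift]
  linarith

variable {B N}

lemma sq_norm_le_inner_gramSum (hN : N ≠ 0) (u : E) : ‖u‖ ^ 2 ≤ inner ℝ (gramSum B N u) u := by
  rw [inner_gramSum_self]
  simpa using Finset.single_le_sum (f := fun k => ‖(B ^ k) u‖ ^ 2) (fun _ _ => by positivity)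
    (Finset.mem_range.2 (Nat.pos_of_ne_zero hN))

lemma isLyapunov_gramSum {T : E →L[ℝ] E} {h : ℝ} (hh : 0 < h) (hN : N ≠ 0)
    (hT : ‖(1 + h • T) ^ N‖ ≤ 1 / 2) :
    IsLyapunov T (gramSum (1 + h • T) N) (3 / (8 * h)) where
  isSymmetric := isSymmetric_gramSum _ _
  sq_norm_le := sq_norm_le_inner_gramSum hN
  pos := by positivity
  inner_apply_le u := by
    set S := gramSum (1 + h • T) N
    have hexpand : inner ℝ (S (u + h • T u)) (u + h • T u)
        = inner ℝ (S u) u + 2 * (h * inner ℝ (S u) (T u)) + inner ℝ (S (h • T u)) (h • T u) := by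
      rw [inner_apply_add_self (isSymmetric_gramSum _ _), inner_smul_right]
    have htelescope : inner ℝ (S (u + h • T u)) (u + h • T u)
        = inner ℝ (S u) u + ‖((1 + h • T) ^ N) u‖ ^ 2 - ‖u‖ ^ 2 :=
      inner_gramSum_apply_self (1 + h • T) N u
    have hcontract : ‖((1 + h • T) ^ N) u‖ ^ 2 ≤ 1 / 4 * ‖u‖ ^ 2 := by
      calc ‖((1 + h • T) ^ N) u‖ ^ 2 ≤ (1 / 2 * ‖u‖) ^ 2 := by
            gcongr; exact ((1 + h • T) ^ N).le_of_opNorm_le hT u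
        _ = 1 / 4 * ‖u‖ ^ 2 := by ring
    have hnonneg : 0 ≤ inner ℝ (S (h • T u)) (h • T u) :=
      (sq_nonneg _).trans (sq_norm_le_inner_gramSum hN _)
    calc inner ℝ (S u) (T u) = 2 * (h * inner ℝ (S u) (T u)) / (2 * h) := by field_simp
      _ ≤ -(3 / 4 * ‖u‖ ^ 2) / (2 * h) := by gcongr; linarith
      _ = -(3 / (8 * h)) * ‖u‖ ^ 2 := by field_simp; ring

end Lyapunov

section Hurwitz

lemma tendsto_pow_of_spectralRadius_lt_one {R : Type*} [NormedRing R] [NormedAlgebra ℂ R]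
    [CompleteSpace R] {a : R} (ha : spectralRadius ℂ a < 1) :
    Tendsto (fun n : ℕ => a ^ n) atTop (𝓝 0) := by
  obtain ⟨r, har, hr⟩ := ENNReal.lt_iff_exists_nnreal_btwn.1 ha
  refine squeeze_zero_norm' (a := fun n : ℕ => (r : ℝ) ^ n) ?_
    (tendsto_pow_atTop_nhds_zero_of_lt_one r.2 (by exact_mod_cast hr))
  filter_upwards [(spectrum.pow_nnnorm_pow_one_div_tendsto_nhds_spectralRadius
    a).eventually_lt_const har, eventually_ne_atTop 0] with n hroot hn
  have hpow := ENNReal.rpow_le_rpow hroot.le n.cast_nonneg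
  rw [one_div, ENNReal.rpow_inv_rpow (by exact_mod_cast hn), ENNReal.rpow_natCast] at hpow
  exact_mod_cast hpow

lemma norm_one_add_ofReal_mul_lt_one {h : ℝ} (hh : 0 < h) {z : ℂ}
    (hz : h * ‖z‖ ^ 2 < -(2 * z.re)) : ‖1 + h * z‖ < 1 := by
  have hsq : ‖1 + (h : ℂ) * z‖ ^ 2 = 1 + h * (2 * z.re + h * ‖z‖ ^ 2) := by
    rw [← Complex.normSq_eq_norm_sq, ← Complex.normSq_eq_norm_sq]
    simp only [Complex.normSq_apply, Complex.add_re, Complex.one_re, Complex.re_ofReal_mul,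
      Complex.add_im, Complex.one_im, Complex.im_ofReal_mul]
    ring
  refine lt_of_pow_lt_pow_left₀ 2 zero_le_one ?_
  rw [hsq]
  nlinarith

lemma exists_spectralRadius_one_add_smul_lt_one {R : Type*} [NormedRing R] [NormedAlgebra ℂ R]
    [CompleteSpace R] {a : R} (ha : ∀ z ∈ spectrum ℂ a, z.re < 0) :
    ∃ h : ℝ, 0 < h ∧ spectralRadius ℂ (1 + (h : ℂ) • a) < 1 := by
  rcases subsingleton_or_nontrivial R with _ | _
  · exact ⟨1, one_pos, by simp⟩
  obtain ⟨c, hc, hσ⟩ := (spectrum.isCompact a).exists_forall_le'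
    (f := fun z : ℂ => -(2 * z.re)) (by fun_prop) (a := 0) fun z hz => by linarith [ha z hz]
  set D := (‖a‖ * ‖(1 : R)‖) ^ 2 + 1
  have hh : 0 < c / D := by positivity
  refine ⟨c / D, hh, ?_⟩
  have hlt := spectrum.spectralRadius_lt_of_forall_lt (1 + ((c / D : ℝ) : ℂ) • a) (r := 1) ?_
  · simpa using hlt
  intro w hw
  rw [← map_one (algebraMap ℂ R), ← spectrum.singleton_add_eq,
    spectrum.smul_eq_smul _ _ (spectrum.nonempty a)] at hw
  obtain ⟨_, rfl, _, ⟨z, hz, rfl⟩, rfl⟩ := hw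
  refine norm_one_add_ofReal_mul_lt_one hh (lt_of_lt_of_le ?_ (hσ z hz))
  calc c / D * ‖z‖ ^ 2 ≤ c / D * (‖a‖ * ‖(1 : R)‖) ^ 2 := by
        gcongr; exact spectrum.norm_le_norm_mul_of_mem hz
    _ < c / D * D := by gcongr; exact lt_add_one _
    _ = c := div_mul_cancel₀ c (by positivity)

variable {d : ℕ} {A : Matrix (Fin d) (Fin d) ℝ}

lemma IsHurwitz.re_neg_of_mem_spectrum (hA : IsHurwitz A) {z : ℂ}
    (hz : z ∈ spectrum ℂ (A.map (algebraMap ℝ ℂ))) : z.re < 0 :=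
  hA z <| Module.End.hasEigenvalue_iff_mem_spectrum.2 <| by
    rwa [← AlgEquiv.spectrum_eq Matrix.toLinAlgEquiv'] at hz

lemma IsHurwitz.exists_tendsto_one_add_smul_pow (hA : IsHurwitz A) :
    ∃ h : ℝ, 0 < h ∧ Tendsto (fun n : ℕ => (1 + h • A) ^ n) atTop (𝓝 0) := by
  obtain ⟨h, hh, hρ⟩ :=
    exists_spectralRadius_one_add_smul_lt_one fun z => hA.re_neg_of_mem_spectrum (z := z)
  refine ⟨h, hh, tendsto_zero_iff_norm_tendsto_zero.2 <| (tendsto_zero_iff_norm_tendsto_zero.1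
    (tendsto_pow_of_spectralRadius_lt_one hρ)).congr fun n => ?_⟩
  have hmap : (1 + (h : ℂ) • A.map (algebraMap ℝ ℂ)) ^ n
      = ((1 + h • A) ^ n).map (algebraMap ℝ ℂ) := by
    rw [show (1 : Matrix (Fin d) (Fin d) ℂ) + (h : ℂ) • A.map (algebraMap ℝ ℂ)
      = (algebraMap ℝ ℂ).mapMatrix (1 + h • A) by ext i j; by_cases hij : i = j <;> simp [hij]]
    exact (map_pow _ _ n).symm
  rw [hmap]
  exact Matrix.frobenius_norm_map_eq _ _ fun x => by simp

theorem IsHurwitz.exists_isLyapunov (hA : IsHurwitz A) :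
    ∃ S c, IsLyapunov (Matrix.toEuclideanCLM (𝕜 := ℝ) A) S c := by
  obtain ⟨h, hh, hpow⟩ := hA.exists_tendsto_one_add_smul_pow
  have hcont : Continuous (Matrix.toEuclideanCLM (n := Fin d) (𝕜 := ℝ)) :=
    LinearMap.continuous_of_finiteDimensional
      (Matrix.toEuclideanCLM (n := Fin d) (𝕜 := ℝ)).toAlgEquiv.toLinearMap
  have hnorm : Tendsto (fun n : ℕ => ‖(1 + h • Matrix.toEuclideanCLM (𝕜 := ℝ) A) ^ n‖)
      atTop (𝓝 0) := by
    simpa using ((hcont.tendsto 0).comp hpow).norm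
  obtain ⟨N, hle, hN⟩ := ((hnorm.eventually_le_const one_half_pos).and
    (eventually_ne_atTop 0)).exists
  exact ⟨_, _, isLyapunov_gramSum hh hN hle⟩

end Hurwitz

section StepSizes

/-- Slowly decreasing step sizes, the class for which Polyak–Ruppert averaging works: `1 / β n`
grows sublinearly with vanishing increments, while the partial sums of `β` are `o(√t)`. -/
structure IsSlowlyDecreasing (β : ℕ → ℝ) : Prop where
  pos : ∀ n, 0 < β n
  antitone : Antitone β
  tendsto_zero : Tendsto β atTop (𝓝 0)
  tendsto_inv_sub_inv : Tendsto (fun n => (β (n + 1))⁻¹ - (β n)⁻¹) atTop (𝓝 0)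
  sum_isLittleO : (fun t => ∑ i ∈ Finset.range t, β i) =o[atTop] fun t : ℕ => √(t : ℝ)

lemma isLittleO_sum_range_sqrt {a : ℕ → ℝ}
    (ha : a =o[atTop] fun i : ℕ => (√((i + 1 : ℕ) : ℝ))⁻¹) :
    (fun t => ∑ i ∈ Finset.range t, a i) =o[atTop] fun t : ℕ => √(t : ℝ) := by
  have hstep (i : ℕ) : √(i : ℝ) ≤ √((i + 1 : ℕ) : ℝ) := Real.sqrt_le_sqrt (by simp)
  have hinv : (fun i : ℕ => (√((i + 1 : ℕ) : ℝ))⁻¹)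
      =O[atTop] fun i : ℕ => √((i + 1 : ℕ) : ℝ) - √(i : ℝ) := by
    refine Asymptotics.IsBigO.of_bound 2 (Eventually.of_forall fun i => ?_)
    have hpos : 0 < √((i + 1 : ℕ) : ℝ) := Real.sqrt_pos.2 (by positivity)
    have hsq : √((i + 1 : ℕ) : ℝ) ^ 2 = √(i : ℝ) ^ 2 + 1 := by
      rw [Real.sq_sqrt (by positivity), Real.sq_sqrt (by positivity), Nat.cast_succ]
    rw [Real.norm_of_nonneg (by positivity), Real.norm_of_nonneg (sub_nonneg.2 (hstep i)),
      inv_le_iff_one_le_mul₀ hpos]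
    nlinarith [hstep i, Real.sqrt_nonneg (i : ℝ)]
  have htelescope (t : ℕ) :
      ∑ i ∈ Finset.range t, (√((i + 1 : ℕ) : ℝ) - √(i : ℝ)) = √(t : ℝ) := by
    rw [Finset.sum_range_sub (fun i : ℕ => √(i : ℝ)), Nat.cast_zero, Real.sqrt_zero, sub_zero]
  simpa only [htelescope] using (ha.trans_isBigO hinv).sum_range
    (fun i => sub_nonneg.2 (hstep i)) (by
      simpa only [htelescope, Function.comp_def] using
        Real.tendsto_sqrt_atTop.comp tendsto_natCast_atTop_atTop)

lemma tendsto_natCast_add_one_rpow_sub_rpow {η : ℝ} (h0 : 0 ≤ η) (h1 : η < 1) :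
    Tendsto (fun n : ℕ => ((n + 1 : ℕ) : ℝ) ^ η - (n : ℝ) ^ η) atTop (𝓝 0) := by
  have hlim : Tendsto (fun n : ℕ => η * (n : ℝ) ^ (-(1 - η))) atTop (𝓝 0) := by
    simpa using ((tendsto_rpow_neg_atTop (sub_pos.2 h1)).comp
      tendsto_natCast_atTop_atTop).const_mul η
  refine squeeze_zero' (Eventually.of_forall fun n => sub_nonneg.2 (by gcongr; simp)) ?_ hlim
  filter_upwards [eventually_gt_atTop 0] with n hn
  have hn' : (0 : ℝ) < n := by exact_mod_cast hn
  have hbernoulli : (1 + (n : ℝ)⁻¹) ^ η ≤ 1 + η * (n : ℝ)⁻¹ :=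
    rpow_one_add_le_one_add_mul_self (by linarith [inv_pos.2 hn']) h0 h1.le
  calc ((n + 1 : ℕ) : ℝ) ^ η - (n : ℝ) ^ η
      = (n : ℝ) ^ η * (1 + (n : ℝ)⁻¹) ^ η - (n : ℝ) ^ η := by
        rw [← Real.mul_rpow hn'.le (by positivity), mul_add, mul_inv_cancel₀ hn'.ne', mul_one,
          Nat.cast_succ]
    _ ≤ (n : ℝ) ^ η * (1 + η * (n : ℝ)⁻¹) - (n : ℝ) ^ η := by gcongr
    _ = η * (n : ℝ) ^ (-(1 - η)) := by
        rw [neg_sub, Real.rpow_sub_one hn'.ne']; ring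

section

variable {α₀ η : ℝ}

lemma isLittleO_stepSize_inv_sqrt (hη : 1 / 2 < η) :
    stepSize α₀ η =o[atTop] fun n : ℕ => (√(n : ℝ))⁻¹ := by
  have hlim : Tendsto (fun n : ℕ => α₀ * (n : ℝ) ^ (-(η - 1 / 2))) atTop (𝓝 0) := by
    simpa using ((tendsto_rpow_neg_atTop (sub_pos.2 hη)).comp
      tendsto_natCast_atTop_atTop).const_mul α₀
  refine Asymptotics.isLittleO_of_tendsto' ?_ (hlim.congr' ?_)
  · filter_upwards [eventually_gt_atTop 0] with n hn h
    exact absurd h (by positivity)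
  · filter_upwards [eventually_gt_atTop 0] with n hn
    rw [stepSize, div_inv_eq_mul, Real.sqrt_eq_rpow, div_mul_eq_mul_div, mul_div_assoc,
      ← Real.rpow_sub (by exact_mod_cast hn), neg_sub]

lemma isSlowlyDecreasing_stepSize (hα₀ : 0 < α₀) (hη : η ∈ Set.Ioo (1 / 2 : ℝ) 1) :
    IsSlowlyDecreasing fun n => stepSize α₀ η (n + 1) where
  pos n := by
    rw [stepSize]
    positivity
  antitone m n hmn := by
    have : 0 ≤ η := by linarith [hη.1]
    simp only [stepSize]
    gcongr
  tendsto_zero := tendsto_const_nhds.div_atTop ((tendsto_rpow_atTop (by linarith [hη.1])).comp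
    (tendsto_natCast_atTop_atTop.comp (tendsto_add_atTop_nat 1)))
  tendsto_inv_sub_inv := by
    have hlim := ((tendsto_natCast_add_one_rpow_sub_rpow (by linarith [hη.1]) hη.2).comp
      (tendsto_add_atTop_nat 1)).const_mul α₀⁻¹
    rw [mul_zero] at hlim
    refine hlim.congr fun n => ?_
    rw [stepSize, stepSize, inv_div, inv_div, Function.comp_apply, mul_sub, div_eq_inv_mul,
      div_eq_inv_mul]
  sum_isLittleO := isLittleO_sum_range_sqrt <|
    (isLittleO_stepSize_inv_sqrt hη.1).comp_tendsto (tendsto_add_atTop_nat 1)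

end

namespace IsSlowlyDecreasing

variable {β : ℕ → ℝ}

lemma succ (hβ : IsSlowlyDecreasing β) : IsSlowlyDecreasing fun n => β (n + 1) where
  pos n := hβ.pos (n + 1)
  antitone m n hmn := hβ.antitone (Nat.succ_le_succ hmn)
  tendsto_zero := hβ.tendsto_zero.comp (tendsto_add_atTop_nat 1)
  tendsto_inv_sub_inv := hβ.tendsto_inv_sub_inv.comp (tendsto_add_atTop_nat 1)
  sum_isLittleO := (Asymptotics.IsBigO.of_norm_le fun t => by
    rw [Real.norm_of_nonneg (Finset.sum_nonneg fun i _ => (hβ.pos (i + 1)).le)]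
    exact Finset.sum_le_sum fun i _ => hβ.antitone i.le_succ).trans_isLittleO hβ.sum_isLittleO

lemma isLittleO_inv_sqrt (hβ : IsSlowlyDecreasing β) :
    (fun t => (√(β t))⁻¹) =o[atTop] fun t : ℕ => √(t : ℝ) := by
  have hinv : (fun t => (β t)⁻¹) =o[atTop] fun t : ℕ => (t : ℝ) := by
    have hsum := Asymptotics.isLittleO_sum_range_of_tendsto_zero hβ.tendsto_inv_sub_inv
    simp only [Finset.sum_range_sub (fun i => (β i)⁻¹)] at hsum
    have hconst : (fun _ : ℕ => (β 0)⁻¹) =o[atTop] fun t : ℕ => (t : ℝ) :=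
      Asymptotics.isLittleO_const_left.2 <| Or.inr <| by
        simpa [Function.comp_def] using tendsto_natCast_atTop_atTop (R := ℝ)
    simpa using hsum.add hconst
  simpa using hinv.sqrt (Eventually.of_forall fun t => t.cast_nonneg)

lemma sub_succ_eq (hβ : IsSlowlyDecreasing β) (n : ℕ) :
    β n - β (n + 1) = ((β (n + 1))⁻¹ - (β n)⁻¹) * (β n * β (n + 1)) := by
  have := (hβ.pos n).ne'
  have := (hβ.pos (n + 1)).ne'
  field_simp

lemma sub_succ_le_of_inv_sub_inv_le (hβ : IsSlowlyDecreasing β) {n : ℕ} {D : ℝ}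
    (hD : (β (n + 1))⁻¹ - (β n)⁻¹ ≤ D) : β n - β (n + 1) ≤ D * β n ^ 2 := by
  have hle : (β n)⁻¹ ≤ (β (n + 1))⁻¹ := inv_anti₀ (hβ.pos _) (hβ.antitone n.le_succ)
  have hprod : β n * β (n + 1) ≤ β n ^ 2 := by
    rw [sq]
    exact mul_le_mul_of_nonneg_left (hβ.antitone n.le_succ) (hβ.pos n).le
  rw [hβ.sub_succ_eq]
  exact mul_le_mul hD hprod (mul_pos (hβ.pos _) (hβ.pos _)).le ((sub_nonneg.2 hle).trans hD)

lemma exists_sub_succ_le (hβ : IsSlowlyDecreasing β) : ∃ D, ∀ n, β n - β (n + 1) ≤ D * β n ^ 2 := by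
  obtain ⟨D, hD⟩ := hβ.tendsto_inv_sub_inv.bddAbove_range
  exact ⟨D, fun n => hβ.sub_succ_le_of_inv_sub_inv_le (hD ⟨n, rfl⟩)⟩

lemma exists_le_mul_of_recursion (hβ : IsSlowlyDecreasing β) {v : ℕ → ℝ} {c C : ℝ} (hc : 0 < c)
    (hv0 : ∀ n, 0 ≤ v n)
    (hv : ∀ᶠ n in atTop, v (n + 1) ≤ (1 - c * β n) * v n + C * β n ^ 2) :
    ∃ K, ∀ n, v n ≤ K * β n := by
  have hsmall := hβ.tendsto_zero.eventually_le_const (inv_pos.2 hc)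
  have hslow := hβ.tendsto_inv_sub_inv.eventually_le_const (half_pos hc)
  obtain ⟨N, hN⟩ := eventually_atTop.1 ((hsmall.and hslow).and hv)
  set K := max (v N / β N) (2 * C / c)
  have hK : 0 ≤ K := le_max_of_le_left (div_nonneg (hv0 N) (hβ.pos N).le)
  have hCK : C ≤ K * (c / 2) := by
    have := (div_le_iff₀ hc).1 (le_max_right (v N / β N) (2 * C / c))
    linarith
  have htail : ∀ n, N ≤ n → v n ≤ K * β n := fun n hn => by
    induction n, hn using Nat.le_induction with
    | base => exact (div_le_iff₀ (hβ.pos N)).1 (le_max_left _ _)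
    | succ n hn ih =>
      obtain ⟨⟨hle, hinv⟩, hrec⟩ := hN n hn
      have hfactor : 0 ≤ 1 - c * β n := by
        rw [sub_nonneg, ← mul_inv_cancel₀ hc.ne']
        gcongr
      calc v (n + 1) ≤ (1 - c * β n) * (K * β n) + K * (c / 2) * β n ^ 2 := by
            refine hrec.trans ?_
            gcongr
        _ = K * (β n - c / 2 * β n ^ 2) := by ring
        _ ≤ K * β (n + 1) := by
            have := hβ.sub_succ_le_of_inv_sub_inv_le hinv
            gcongr
            linarith
  have hbigO : v =O[atTop] β := .of_bound K <| eventually_atTop.2 ⟨N, fun n hn => by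
    rw [Real.norm_of_nonneg (hv0 n), Real.norm_of_nonneg (hβ.pos n).le]
    exact htail n hn⟩
  obtain ⟨K', -, hK'⟩ := Asymptotics.bound_of_isBigO_nat_atTop hbigO
  refine ⟨K', fun n => ?_⟩
  simpa only [Real.norm_of_nonneg (hv0 n), Real.norm_of_nonneg (hβ.pos n).le]
    using hK' (hβ.pos n).ne'

end IsSlowlyDecreasing

lemma sum_range_smul_sub {F : Type*} [AddCommGroup F] [Module ℝ F] (c : ℕ → ℝ) (x : ℕ → F)
    (t : ℕ) : ∑ i ∈ Finset.range t, c i • (x (i + 1) - x i)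
      = c t • x t - c 0 • x 0 - ∑ i ∈ Finset.range t, (c (i + 1) - c i) • x (i + 1) := by
  rw [eq_sub_iff_add_eq, ← Finset.sum_add_distrib,
    ← Finset.sum_range_sub (fun i => c i • x i)]
  exact Finset.sum_congr rfl fun i _ => by module

lemma sum_range_sq_sub_sq_mul_le {s v : ℕ → ℝ} {K : ℝ} (hs : ∀ n, 0 < s n) (hmono : Monotone s)
    (hK : 0 ≤ K) (hv : ∀ n, s n * v n ≤ K) (t : ℕ) :
    s t ^ 2 * v t + s 0 ^ 2 * v 0 + ∑ i ∈ Finset.range t, (s (i + 1) ^ 2 - s i ^ 2) * v (i + 1)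
      ≤ 3 * K * s t := by
  have hend (n : ℕ) : s n ^ 2 * v n ≤ K * s n := by
    nlinarith [mul_le_mul_of_nonneg_left (hv n) (hs n).le]
  have hterm (i : ℕ) :
      (s (i + 1) ^ 2 - s i ^ 2) * v (i + 1) ≤ 2 * K * (s (i + 1) - s i) := by
    have hstep : 0 ≤ s (i + 1) - s i := sub_nonneg.2 (hmono i.le_succ)
    have hsum : (s (i + 1) + s i) * v (i + 1) ≤ 2 * K := by
      rcases le_total 0 (v (i + 1)) with hpos | hneg
      · nlinarith [mul_le_mul_of_nonneg_right (hmono i.le_succ) hpos, hv (i + 1)]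
      · nlinarith [hs i, hs (i + 1)]
    nlinarith [mul_le_mul_of_nonneg_left hsum hstep]
  have hsum := Finset.sum_le_sum fun i (_ : i ∈ Finset.range t) => hterm i
  rw [← Finset.mul_sum, Finset.sum_range_sub s] at hsum
  nlinarith [hend t, hend 0, mul_nonneg hK (hs 0).le]

end StepSizes

section ErrorPath

variable {E : Type*} [NormedAddCommGroup E] [NormedSpace ℝ E]

/-- Evaluation at `u` of the affine map `v ↦ p.1 v + p.2`, as a linear function of the pair `p`
that encodes the affine map. -/
noncomputable def affineEval (u : E) : (E →L[ℝ] E) × E →L[ℝ] E :=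
  ContinuousLinearMap.apply ℝ E u ∘L ContinuousLinearMap.fst ℝ _ _ + ContinuousLinearMap.snd ℝ _ _

lemma affineEval_apply (u : E) (p : (E →L[ℝ] E) × E) : affineEval u p = p.1 u + p.2 := rfl

lemma affineEval_sub_affineEval (u v : E) (p : (E →L[ℝ] E) × E) :
    affineEval u p - affineEval v p = p.1 (u - v) := by
  rw [affineEval_apply, affineEval_apply, add_sub_add_right_eq_sub, map_sub]

lemma norm_affineEval_le {p : (E →L[ℝ] E) × E} {C : ℝ} (hp : ‖p‖ ≤ C) (u : E) :
    ‖affineEval u p‖ ≤ C * (1 + ‖u‖) := by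
  rw [Prod.norm_def] at hp
  calc ‖affineEval u p‖ ≤ C * ‖u‖ + C :=
        norm_add_le_of_le (p.1.le_of_opNorm_le ((le_max_left _ _).trans hp) u)
          ((le_max_right _ _).trans hp)
    _ = C * (1 + ‖u‖) := by ring

/-- A trajectory of the error recursion
`e (n + 1) = e n + β n • (T (e n) + noise at e n)`, whose noise is the random affine map
`M n + (H n - H (n + 1))` with `M` and `H` bounded by `C`. -/
structure IsErrorPath (β : ℕ → ℝ) (T : E →L[ℝ] E) (C : ℝ) (M H : ℕ → (E →L[ℝ] E) × E)
    (e : ℕ → E) : Prop where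
  norm_incr_le : ∀ n, ‖M n‖ ≤ C
  norm_corr_le : ∀ n, ‖H n‖ ≤ C
  step : ∀ n, e (n + 1) = e n + β n • (T (e n) + affineEval (e n) (M n + (H n - H (n + 1))))

/-- The error corrected by `β n` times the corrector: it absorbs the telescoping part of the
noise, so that up to second order only the martingale part is left. -/
noncomputable def correctedError (β : ℕ → ℝ) (H : ℕ → (E →L[ℝ] E) × E) (e : ℕ → E) (n : ℕ) : E :=
  e n + β n • affineEval (e n) (H n)

/-- The second-order remainder in the recursion satisfied by `correctedError`. -/
noncomputable def correctionRemainder (β : ℕ → ℝ) (H : ℕ → (E →L[ℝ] E) × E) (e : ℕ → E)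
    (n : ℕ) : E :=
  β (n + 1) • affineEval (e (n + 1)) (H (n + 1)) - β n • affineEval (e n) (H (n + 1))

namespace IsErrorPath

variable {β : ℕ → ℝ} {T : E →L[ℝ] E} {C : ℝ} {M H : ℕ → (E →L[ℝ] E) × E} {e : ℕ → E}

lemma correctedError_succ (he : IsErrorPath β T C M H e) (n : ℕ) :
    correctedError β H e (n + 1) = correctedError β H e n
      + β n • (T (e n) + affineEval (e n) (M n)) + correctionRemainder β H e n := by
  rw [correctedError, correctedError, correctionRemainder]
  nth_rewrite 1 [he.step n]
  rw [map_add, map_sub]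
  module

lemma sum_range_linear_eq (he : IsErrorPath β T C M H e) (hβ : ∀ n, β n ≠ 0) (t : ℕ) :
    ∑ i ∈ Finset.range t, (T (e i) + (M i + (H i - H (i + 1))).2)
      = ∑ i ∈ Finset.range t,
          (β i)⁻¹ • (correctedError β H e (i + 1) - correctedError β H e i)
        - ∑ i ∈ Finset.range t, (M i).1 (e i)
        - ∑ i ∈ Finset.range t, (β i)⁻¹ • correctionRemainder β H e i + (H 0 - H t).2 := by
  have hcorr : ∑ i ∈ Finset.range t, ((H i).2 - (H (i + 1)).2) = (H 0 - H t).2 :=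
    Finset.sum_range_sub' (fun i => (H i).2) t
  rw [← hcorr, ← Finset.sum_sub_distrib, ← Finset.sum_sub_distrib, ← Finset.sum_add_distrib]
  refine Finset.sum_congr rfl fun i _ => ?_
  rw [he.correctedError_succ, add_assoc, add_sub_cancel_left, smul_add, inv_smul_smul₀ (hβ i),
    affineEval_apply, Prod.snd_add, Prod.snd_sub]
  abel

lemma bound_nonneg (he : IsErrorPath β T C M H e) : 0 ≤ C :=
  (norm_nonneg _).trans (he.norm_corr_le 0)

variable {n : ℕ}

lemma norm_correctedError_sub_le (he : IsErrorPath β T C M H e) (hβ : 0 ≤ β n) :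
    ‖correctedError β H e n - e n‖ ≤ β n * (C * (1 + ‖e n‖)) := by
  rw [correctedError, add_sub_cancel_left, norm_smul, Real.norm_of_nonneg hβ]
  gcongr
  exact norm_affineEval_le (he.norm_corr_le n) _

lemma one_add_norm_le (he : IsErrorPath β T C M H e) (hβ : 0 ≤ β n) (hβC : β n * C ≤ 1 / 2) :
    1 + ‖e n‖ ≤ 2 * (1 + ‖correctedError β H e n‖) := by
  have hsub : ‖e n‖ ≤ ‖correctedError β H e n‖ + ‖correctedError β H e n - e n‖ :=
    (norm_le_norm_add_norm_sub _ _)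
  nlinarith [he.norm_correctedError_sub_le hβ,
    mul_le_mul_of_nonneg_right hβC (by positivity : 0 ≤ 1 + ‖e n‖),
    norm_nonneg (correctedError β H e n)]

lemma norm_sub_le (he : IsErrorPath β T C M H e) (hβ : 0 ≤ β n) :
    ‖e (n + 1) - e n‖ ≤ β n * ((‖T‖ + 3 * C) * (1 + ‖e n‖)) := by
  have hnoise : ‖M n + (H n - H (n + 1))‖ ≤ C + (C + C) :=
    norm_add_le_of_le (he.norm_incr_le n)
      (norm_sub_le_of_le (he.norm_corr_le n) (he.norm_corr_le _))
  rw [he.step n, add_sub_cancel_left, norm_smul, Real.norm_of_nonneg hβ]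
  gcongr
  refine (norm_add_le_of_le (T.le_opNorm _) (norm_affineEval_le hnoise _)).trans ?_
  nlinarith [norm_nonneg T]

lemma norm_correctionRemainder_le (he : IsErrorPath β T C M H e) (hβ : 0 ≤ β (n + 1))
    (hanti : β (n + 1) ≤ β n) {D : ℝ} (hD : β n - β (n + 1) ≤ D * β n ^ 2) :
    ‖correctionRemainder β H e n‖ ≤ C * (‖T‖ + 3 * C + D) * β n ^ 2 * (1 + ‖e n‖) := by
  have hsplit : correctionRemainder β H e n = β (n + 1) • (H (n + 1)).1 (e (n + 1) - e n)
      - (β n - β (n + 1)) • affineEval (e n) (H (n + 1)) := by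
    rw [correctionRemainder, ← affineEval_sub_affineEval]
    module
  have hC := he.bound_nonneg
  have hlinear : ‖(H (n + 1)).1‖ ≤ C := (norm_fst_le _).trans (he.norm_corr_le _)
  have hshift : ‖β (n + 1) • (H (n + 1)).1 (e (n + 1) - e n)‖
      ≤ β n * (C * (β n * ((‖T‖ + 3 * C) * (1 + ‖e n‖)))) := by
    rw [norm_smul, Real.norm_of_nonneg hβ]
    gcongr
    · exact hβ.trans hanti
    · exact ((H (n + 1)).1.le_of_opNorm_le hlinear _).trans
        (mul_le_mul_of_nonneg_left (he.norm_sub_le (hβ.trans hanti)) hC)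
  have hslope : ‖(β n - β (n + 1)) • affineEval (e n) (H (n + 1))‖
      ≤ D * β n ^ 2 * (C * (1 + ‖e n‖)) := by
    rw [norm_smul, Real.norm_of_nonneg (sub_nonneg.2 hanti)]
    gcongr
    · exact (sub_nonneg.2 hanti).trans hD
    · exact norm_affineEval_le (he.norm_corr_le _) _
  rw [hsplit]
  exact (norm_sub_le_of_le hshift hslope).trans_eq (by ring)

lemma correctedError_succ_eq_add_drift (he : IsErrorPath β T C M H e) (n : ℕ) :
    correctedError β H e (n + 1) = correctedError β H e n
      + (β n • (T (correctedError β H e n) + affineEval (e n) (M n))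
        + (correctionRemainder β H e n - β n • T (correctedError β H e n - e n))) := by
  rw [he.correctedError_succ, map_sub]
  module

lemma norm_correctionRemainder_sub_le (he : IsErrorPath β T C M H e) (hβ : 0 ≤ β (n + 1))
    (hanti : β (n + 1) ≤ β n) {D : ℝ} (hD : β n - β (n + 1) ≤ D * β n ^ 2) :
    ‖correctionRemainder β H e n - β n • T (correctedError β H e n - e n)‖
      ≤ C * (2 * ‖T‖ + 3 * C + D) * β n ^ 2 * (1 + ‖e n‖) := by
  have hβn := hβ.trans hanti
  have hdrift : ‖β n • T (correctedError β H e n - e n)‖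
      ≤ β n * (‖T‖ * (β n * (C * (1 + ‖e n‖)))) := by
    rw [norm_smul, Real.norm_of_nonneg hβn]
    gcongr
    exact (T.le_opNorm _).trans (by gcongr; exact he.norm_correctedError_sub_le hβn)
  exact (norm_sub_le_of_le (he.norm_correctionRemainder_le hβ hanti hD) hdrift).trans_eq (by ring)

end IsErrorPath

end ErrorPath

section LyapunovRecursion

variable {E : Type*} [NormedAddCommGroup E] [InnerProductSpace ℝ E]
  {T S : E →L[ℝ] E} {c : ℝ}

lemma inner_apply_self_le (S : E →L[ℝ] E) (u : E) : inner ℝ (S u) u ≤ ‖S‖ * ‖u‖ ^ 2 := by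
  calc inner ℝ (S u) u ≤ ‖S‖ * ‖u‖ * ‖u‖ :=
        (real_inner_le_norm _ _).trans (by gcongr; exact S.le_opNorm u)
    _ = ‖S‖ * ‖u‖ ^ 2 := by ring

namespace IsLyapunov

lemma inner_apply_self_step_le (hS : IsLyapunov T S c) {a D : ℝ} (ha0 : 0 ≤ a) (ha1 : a ≤ 1)
    {x N w : E} (hN : ‖N‖ ≤ D * (1 + ‖x‖)) (hw : ‖w‖ ≤ D * a ^ 2 * (1 + ‖x‖)) :
    inner ℝ (S (x + (a • (T x + N) + w))) (x + (a • (T x + N) + w))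
      ≤ inner ℝ (S x) x - 2 * c * a * ‖x‖ ^ 2 + 2 * a * inner ℝ (S x) N
        + (4 * ‖S‖ * D + 2 * ‖S‖ * (‖T‖ + 2 * D) ^ 2) * (a ^ 2 * (1 + ‖x‖ ^ 2)) := by
  have hD : 0 ≤ D := nonneg_of_mul_nonneg_left ((norm_nonneg _).trans hN) (by positivity)
  have hsq : (1 + ‖x‖) ^ 2 ≤ 2 * (1 + ‖x‖ ^ 2) := by nlinarith [sq_nonneg (1 - ‖x‖)]
  have hincr : ‖a • (T x + N) + w‖ ≤ (‖T‖ + 2 * D) * (a * (1 + ‖x‖)) := by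
    have hdrift : ‖a • (T x + N)‖ ≤ a * (‖T‖ * ‖x‖ + D * (1 + ‖x‖)) := by
      rw [norm_smul, Real.norm_of_nonneg ha0]
      gcongr
      exact norm_add_le_of_le (T.le_opNorm x) hN
    have hwa : ‖w‖ ≤ D * a * (1 + ‖x‖) := hw.trans (by gcongr; nlinarith)
    nlinarith [norm_add_le_of_le hdrift hwa, mul_nonneg ha0 (norm_nonneg T)]
  have hquad : inner ℝ (S (a • (T x + N) + w)) (a • (T x + N) + w)
      ≤ 2 * ‖S‖ * (‖T‖ + 2 * D) ^ 2 * (a ^ 2 * (1 + ‖x‖ ^ 2)) := by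
    calc inner ℝ (S (a • (T x + N) + w)) (a • (T x + N) + w)
        ≤ ‖S‖ * ((‖T‖ + 2 * D) * (a * (1 + ‖x‖))) ^ 2 :=
          (inner_apply_self_le S _).trans (by gcongr)
      _ = ‖S‖ * (‖T‖ + 2 * D) ^ 2 * a ^ 2 * (1 + ‖x‖) ^ 2 := by ring
      _ ≤ ‖S‖ * (‖T‖ + 2 * D) ^ 2 * a ^ 2 * (2 * (1 + ‖x‖ ^ 2)) := by gcongr
      _ = 2 * ‖S‖ * (‖T‖ + 2 * D) ^ 2 * (a ^ 2 * (1 + ‖x‖ ^ 2)) := by ring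
  have hrem : inner ℝ (S x) w ≤ 2 * ‖S‖ * D * (a ^ 2 * (1 + ‖x‖ ^ 2)) := by
    calc inner ℝ (S x) w ≤ ‖S‖ * (1 + ‖x‖) * (D * a ^ 2 * (1 + ‖x‖)) := by
          refine (real_inner_le_norm _ _).trans ?_
          gcongr
          exact (S.le_opNorm x).trans (by gcongr; linarith)
      _ = ‖S‖ * D * a ^ 2 * (1 + ‖x‖) ^ 2 := by ring
      _ ≤ ‖S‖ * D * a ^ 2 * (2 * (1 + ‖x‖ ^ 2)) := by gcongr
      _ = 2 * ‖S‖ * D * (a ^ 2 * (1 + ‖x‖ ^ 2)) := by ring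
  rw [inner_apply_add_self hS.isSymmetric, inner_add_right, real_inner_smul_right,
    inner_add_right]
  nlinarith [mul_le_mul_of_nonneg_left (hS.inner_apply_le x) ha0]

lemma inner_apply_self_step_le_of_small (hS : IsLyapunov T S c) {a D K : ℝ} (ha0 : 0 ≤ a)
    (ha1 : a ≤ 1) (hK : K = 4 * ‖S‖ * D + 2 * ‖S‖ * (‖T‖ + 2 * D) ^ 2) (haK : K * a ≤ c)
    {x N w : E} (hN : ‖N‖ ≤ D * (1 + ‖x‖)) (hw : ‖w‖ ≤ D * a ^ 2 * (1 + ‖x‖)) :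
    inner ℝ (S (x + (a • (T x + N) + w))) (x + (a • (T x + N) + w))
      ≤ (1 - c / (‖S‖ + 1) * a) * inner ℝ (S x) x + K * a ^ 2 + 2 * a * inner ℝ (S x) N := by
  have hV : c / (‖S‖ + 1) * inner ℝ (S x) x ≤ c * ‖x‖ ^ 2 := by
    rw [div_mul_eq_mul_div, div_le_iff₀ (by positivity), mul_assoc]
    refine mul_le_mul_of_nonneg_left ?_ hS.pos.le
    nlinarith [inner_apply_self_le S x, sq_nonneg ‖x‖]
  have hstep := hS.inner_apply_self_step_le ha0 ha1 hN hw
  rw [← hK] at hstep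
  nlinarith [mul_le_mul_of_nonneg_left hV ha0,
    mul_le_mul_of_nonneg_right haK (mul_nonneg ha0 (sq_nonneg ‖x‖))]

end IsLyapunov

theorem IsSlowlyDecreasing.exists_lyapunov_recursion {β : ℕ → ℝ} (hβ : IsSlowlyDecreasing β)
    (hS : IsLyapunov T S c) (C : ℝ) :
    ∃ K, ∀ᶠ n in atTop, ∀ {M H : ℕ → (E →L[ℝ] E) × E} {e : ℕ → E}, IsErrorPath β T C M H e →
      inner ℝ (S (correctedError β H e (n + 1))) (correctedError β H e (n + 1))
        ≤ (1 - c / (‖S‖ + 1) * β n) * inner ℝ (S (correctedError β H e n)) (correctedError β H e n)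
          + K * β n ^ 2
          + 2 * β n * inner ℝ (S (correctedError β H e n)) (affineEval (e n) (M n)) := by
  obtain ⟨B, hB⟩ := hβ.exists_sub_succ_le
  have hB0 : 0 ≤ B := nonneg_of_mul_nonneg_left
    ((sub_nonneg.2 (hβ.antitone (Nat.le_succ 0))).trans (hB 0)) (pow_pos (hβ.pos 0) 2)
  set D := 2 * (C * (2 * ‖T‖ + 3 * C + B + 1)) with hD
  set K := 4 * ‖S‖ * D + 2 * ‖S‖ * (‖T‖ + 2 * D) ^ 2 with hK
  have hsmall (b r : ℝ) (hr : 0 < r) : ∀ᶠ n in atTop, β n * b ≤ r :=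
    (hβ.tendsto_zero.mul_const b).eventually_le_const (by simpa using hr)
  refine ⟨K, ?_⟩
  filter_upwards [hβ.tendsto_zero.eventually_le_const one_pos, hsmall C (1 / 2) one_half_pos,
    hsmall K c hS.pos] with n hβ1 hβC hβK M H e he
  have hβ0 := (hβ.pos n).le
  have hC := he.bound_nonneg
  have hex := he.one_add_norm_le hβ0 hβC
  have hnoise : ‖affineEval (e n) (M n)‖ ≤ D * (1 + ‖correctedError β H e n‖) :=
    calc ‖affineEval (e n) (M n)‖ ≤ C * 1 * (1 + ‖e n‖) := by
          rw [mul_one]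
          exact norm_affineEval_le (he.norm_incr_le n) (e n)
      _ ≤ C * (2 * ‖T‖ + 3 * C + B + 1) * (2 * (1 + ‖correctedError β H e n‖)) := by
          gcongr
          exact le_add_of_nonneg_left (by positivity)
      _ = D * (1 + ‖correctedError β H e n‖) := by rw [hD]; ring
  have hrem : ‖correctionRemainder β H e n - β n • T (correctedError β H e n - e n)‖
      ≤ D * β n ^ 2 * (1 + ‖correctedError β H e n‖) :=
    calc ‖correctionRemainder β H e n - β n • T (correctedError β H e n - e n)‖
        ≤ C * (2 * ‖T‖ + 3 * C + B) * β n ^ 2 * (1 + ‖e n‖) :=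
          he.norm_correctionRemainder_sub_le (hβ.pos _).le (hβ.antitone n.le_succ) (hB n)
      _ ≤ C * (2 * ‖T‖ + 3 * C + B + 1) * β n ^ 2
            * (2 * (1 + ‖correctedError β H e n‖)) := by
          have := le_add_of_nonneg_right (a := 2 * ‖T‖ + 3 * C + B) zero_le_one
          gcongr
      _ = D * β n ^ 2 * (1 + ‖correctedError β H e n‖) := by rw [hD]; ring
  rw [he.correctedError_succ_eq_add_drift]
  exact hS.inner_apply_self_step_le_of_small hβ0 hβ1 hK (mul_comm K _ ▸ hβK) hnoise hrem

end LyapunovRecursion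

section LpBounds

open scoped ENNReal

variable {Ω F G : Type*} {mΩ : MeasurableSpace Ω} {P : Measure Ω} {p : ℝ≥0∞}
  [NormedAddCommGroup F] [NormedAddCommGroup G]

lemma lpNorm_le_of_ae_norm_le {f : Ω → F} {g : Ω → ℝ} (hf : AEStronglyMeasurable f P)
    (hg : MemLp g p P) (h : ∀ᵐ ω ∂P, ‖f ω‖ ≤ g ω) : lpNorm f p P ≤ lpNorm g p P := by
  rw [← toReal_eLpNorm hf, ← toReal_eLpNorm hg.aestronglyMeasurable]
  exact ENNReal.toReal_mono hg.eLpNorm_ne_top (eLpNorm_mono_ae_real h)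

lemma lpNorm_congr_ae {f g : Ω → F} (hf : AEStronglyMeasurable f P) (h : f =ᵐ[P] g) :
    lpNorm f p P = lpNorm g p P := by
  rw [← toReal_eLpNorm hf, ← toReal_eLpNorm (hf.congr h), eLpNorm_congr_ae h]

lemma lpNorm_le_of_ae_norm_le_const [IsProbabilityMeasure P] {f : Ω → F} {C : ℝ}
    (hf : AEStronglyMeasurable f P) (hp : p ≠ 0) (hC : 0 ≤ C) (h : ∀ᵐ ω ∂P, ‖f ω‖ ≤ C) :
    lpNorm f p P ≤ C := by
  refine (lpNorm_le_of_ae_norm_le hf (memLp_const C) h).trans_eq ?_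
  rw [lpNorm_const hp (IsProbabilityMeasure.ne_zero P), Real.norm_of_nonneg hC]
  simp

lemma lpNorm_le_mul_lpNorm {f : Ω → F} {g : Ω → G} {C : ℝ} (hC : 0 ≤ C)
    (hf : AEStronglyMeasurable f P) (hg : MemLp g p P) (h : ∀ᵐ ω ∂P, ‖f ω‖ ≤ C * ‖g ω‖) :
    lpNorm f p P ≤ C * lpNorm g p P := by
  refine (lpNorm_le_of_ae_norm_le hf (hg.norm.const_smul C) h).trans_eq ?_
  rw [lpNorm_const_smul, lpNorm_norm hg.aestronglyMeasurable, coe_nnnorm, Real.norm_of_nonneg hC]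

lemma memLp_of_ae_norm_le_mul_one_add [IsFiniteMeasure P] {f : Ω → F} {g : Ω → G} {C : ℝ}
    (hf : AEStronglyMeasurable f P) (hg : MemLp g p P) (h : ∀ᵐ ω ∂P, ‖f ω‖ ≤ C * (1 + ‖g ω‖)) :
    MemLp f p P := by
  have hg' : MemLp (fun ω => 1 + ‖g ω‖) p P := (memLp_const (1 : ℝ)).add hg.norm
  refine hg'.of_le_mul (c := C) hf (h.mono fun ω hω => ?_)
  rwa [Real.norm_of_nonneg (by positivity)]

lemma memLp_of_ae_norm_sub_le_mul_one_add [IsFiniteMeasure P] {f g : Ω → F} {C : ℝ}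
    (hf : AEStronglyMeasurable f P) (hg : MemLp g p P)
    (h : ∀ᵐ ω ∂P, ‖f ω - g ω‖ ≤ C * (1 + ‖g ω‖)) : MemLp f p P :=
  (memLp_congr_ae (ae_of_all _ fun _ => add_sub_cancel _ _)).1
    (hg.add (memLp_of_ae_norm_le_mul_one_add (hf.sub hg.aestronglyMeasurable) hg h))

lemma lpNorm_le_mul_one_add [IsProbabilityMeasure P] {f : Ω → F} {g : Ω → G} {C : ℝ}
    (hp : 1 ≤ p) (hC : 0 ≤ C) (hf : AEStronglyMeasurable f P) (hg : MemLp g p P)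
    (h : ∀ᵐ ω ∂P, ‖f ω‖ ≤ C * (1 + ‖g ω‖)) : lpNorm f p P ≤ C * (1 + lpNorm g p P) := by
  have hg' : MemLp (fun ω => 1 + ‖g ω‖) p P := (memLp_const (1 : ℝ)).add hg.norm
  have hadd : lpNorm (fun ω => 1 + ‖g ω‖) p P ≤ 1 + lpNorm g p P := by
    refine (lpNorm_add_le (memLp_const (1 : ℝ)) hp (g := fun ω => ‖g ω‖)).trans_eq ?_
    rw [lpNorm_norm hg.aestronglyMeasurable,
      lpNorm_const (one_pos.trans_le hp).ne' (IsProbabilityMeasure.ne_zero P)]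
    simp
  refine (lpNorm_le_mul_lpNorm hC hf hg' (h.mono fun ω hω => ?_)).trans (by gcongr)
  rwa [Real.norm_of_nonneg (by positivity)]

variable [NormedSpace ℝ F]

lemma lpNorm_sum_range_smul_sub_le (hp : 1 ≤ p) {c : ℕ → ℝ} (hc : ∀ n, 0 ≤ c n)
    (hmono : Monotone c) {x : ℕ → Ω → F} (hx : ∀ n, MemLp (x n) p P) (t : ℕ) :
    lpNorm (∑ i ∈ Finset.range t, c i • (x (i + 1) - x i)) p P
      ≤ c t * lpNorm (x t) p P + c 0 * lpNorm (x 0) p P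
        + ∑ i ∈ Finset.range t, (c (i + 1) - c i) * lpNorm (x (i + 1)) p P := by
  have hsmul {a : ℝ} (ha : 0 ≤ a) (n : ℕ) : lpNorm (a • x n) p P = a * lpNorm (x n) p P := by
    rw [lpNorm_const_smul, coe_nnnorm, Real.norm_of_nonneg ha]
  have hincr (i : ℕ) : 0 ≤ c (i + 1) - c i := sub_nonneg.2 (hmono i.le_succ)
  have hmem (a : ℝ) (n : ℕ) : MemLp (a • x n) p P := (hx n).const_smul a
  rw [sum_range_smul_sub, ← hsmul (hc t), ← hsmul (hc 0)]
  simp_rw [← hsmul (hincr _)]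
  exact (lpNorm_sub_le ((hmem _ _).sub (hmem _ _)) hp).trans
    (add_le_add (lpNorm_sub_le (hmem _ _) hp) (lpNorm_sum_le (fun _ _ => hmem _ _) hp))

lemma tendstoInMeasure_inv_smul_of_isLittleO_lpNorm {ι : Type*} {l : Filter ι} {Z : ι → Ω → F}
    {r : ι → ℝ} (hp : p ≠ 0) (hZ : ∀ i, MemLp (Z i) p P)
    (h : (fun i => lpNorm (Z i) p P) =o[l] r) :
    TendstoInMeasure P (fun i ω => (r i)⁻¹ • Z i ω) l (fun _ => 0) := by
  have hmem (i : ι) : MemLp (fun ω => (r i)⁻¹ • Z i ω) p P := (hZ i).const_smul _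
  refine tendstoInMeasure_of_tendsto_eLpNorm hp (fun i => (hmem i).aestronglyMeasurable)
    aestronglyMeasurable_const ?_
  have hnorm (i : ι) : eLpNorm ((fun ω => (r i)⁻¹ • Z i ω) - fun _ => 0) p P
      = ENNReal.ofReal ‖lpNorm (Z i) p P / r i‖ := by
    have hsmul : lpNorm (fun ω => (r i)⁻¹ • Z i ω) p P = ‖(r i)⁻¹‖ * lpNorm (Z i) p P :=
      lpNorm_const_smul _ _ _
    rw [← Pi.zero_def, sub_zero, ← ofReal_lpNorm (hmem i), hsmul, div_eq_inv_mul, norm_mul,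
      Real.norm_of_nonneg (lpNorm_nonneg (f := Z i))]
  simp_rw [hnorm]
  rw [← ENNReal.ofReal_zero, ← norm_zero (E := ℝ)]
  exact ENNReal.tendsto_ofReal h.tendsto_div_nhds_zero.norm

end LpBounds

section SecondMoments

variable {Ω E : Type*} {mΩ : MeasurableSpace Ω} {P : Measure Ω} [NormedAddCommGroup E]

lemma lpNorm_two_sq {f : Ω → E} (hf : AEStronglyMeasurable f P) :
    lpNorm f 2 P ^ 2 = ∫ ω, ‖f ω‖ ^ 2 ∂P := by
  rw [lpNorm_eq_integral_norm_rpow_toReal two_ne_zero ENNReal.ofNat_ne_top hf,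
    ← Real.rpow_natCast, ← Real.rpow_mul (by positivity)]
  simp

variable [InnerProductSpace ℝ E]

lemma integrable_inner_of_memLp_two {f g : Ω → E} (hf : MemLp f 2 P) (hg : MemLp g 2 P) :
    Integrable (fun ω => inner ℝ (f ω) (g ω)) P :=
  memLp_one_iff_integrable.1 (ContinuousLinearMap.memLp_of_bilin 1 (innerSL ℝ) hf hg)

lemma lpNorm_two_add_sq_of_integral_inner_eq_zero {f g : Ω → E} (hf : MemLp f 2 P)
    (hg : MemLp g 2 P) (h : ∫ ω, inner ℝ (f ω) (g ω) ∂P = 0) :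
    lpNorm (f + g) 2 P ^ 2 = lpNorm f 2 P ^ 2 + lpNorm g 2 P ^ 2 := by
  have hfi := hf.integrable_norm_pow two_ne_zero
  have hgi := hg.integrable_norm_pow two_ne_zero
  have hfgi := (integrable_inner_of_memLp_two hf hg).const_mul 2
  rw [lpNorm_two_sq (hf.add hg).aestronglyMeasurable, lpNorm_two_sq hf.aestronglyMeasurable,
    lpNorm_two_sq hg.aestronglyMeasurable]
  calc ∫ ω, ‖(f + g) ω‖ ^ 2 ∂P
      = ∫ ω, (‖f ω‖ ^ 2 + ‖g ω‖ ^ 2 + 2 * inner ℝ (f ω) (g ω)) ∂P := by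
        refine integral_congr_ae (ae_of_all _ fun ω => ?_)
        simpa [add_right_comm] using norm_add_sq_real (f ω) (g ω)
    _ = ∫ ω, ‖f ω‖ ^ 2 ∂P + ∫ ω, ‖g ω‖ ^ 2 ∂P := by
        rw [integral_add (hfi.fun_add hgi) hfgi, integral_add hfi hgi, integral_const_mul, h,
          mul_zero, add_zero]

lemma lpNorm_two_sum_range_sq_of_integral_inner_eq_zero {D : ℕ → Ω → E}
    (hD : ∀ n, MemLp (D n) 2 P)
    (h : ∀ n, ∫ ω, inner ℝ ((∑ i ∈ Finset.range n, D i) ω) (D n ω) ∂P = 0) (t : ℕ) :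
    lpNorm (∑ i ∈ Finset.range t, D i) 2 P ^ 2 = ∑ i ∈ Finset.range t, lpNorm (D i) 2 P ^ 2 := by
  induction t with
  | zero => simp
  | succ t ih =>
    rw [Finset.sum_range_succ, Finset.sum_range_succ, ← ih]
    exact lpNorm_two_add_sq_of_integral_inner_eq_zero (memLp_finsetSum' _ fun i _ => hD i) (hD t)
      (h t)

end SecondMoments

section ErrorSequence

variable {Ω E : Type*} {mΩ : MeasurableSpace Ω} [NormedAddCommGroup E] [InnerProductSpace ℝ E]

lemma continuous_affineEval : Continuous (affineEval : E → (E →L[ℝ] E) × E →L[ℝ] E) := by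
  unfold affineEval
  fun_prop

lemma stronglyMeasurable_affineEval {m : MeasurableSpace Ω} {u : Ω → E}
    {p : Ω → (E →L[ℝ] E) × E} (hu : StronglyMeasurable[m] u) (hp : StronglyMeasurable[m] p) :
    StronglyMeasurable[m] fun ω => affineEval (u ω) (p ω) :=
  isBoundedBilinearMap_apply.continuous.comp_stronglyMeasurable
    ((continuous_affineEval.comp_stronglyMeasurable hu).prodMk hp)

lemma IsBoundedNoise.integral_inner_clm_eq_zero {F : Type*} [NormedAddCommGroup F]
    [NormedSpace ℝ F] [CompleteSpace F] {P : Measure Ω} [IsFiniteMeasure P] {𝓕 : Filtration ℕ mΩ}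
    {C : ℝ} {M H : ℕ → Ω → F} (h : IsBoundedNoise P 𝓕 C M H) {n : ℕ} {L : Ω → F →L[ℝ] E}
    {y : Ω → E} (hL : StronglyMeasurable[𝓕 n] L) (hy : StronglyMeasurable[𝓕 n] y)
    (hi : Integrable (fun ω => inner ℝ (y ω) (L ω (M n ω))) P) :
    ∫ ω, inner ℝ (y ω) (L ω (M n ω)) ∂P = 0 := by
  have hM : Integrable (M n) P :=
    Integrable.of_bound ((h.stronglyMeasurable_incr n).mono (𝓕.le _)).aestronglyMeasurable C
      (h.norm_incr_le n)
  have hcont : Continuous fun p : E × (F →L[ℝ] E) => innerSL ℝ p.1 ∘L p.2 := by fun_prop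
  exact integral_clm_apply_eq_zero_of_condExp_eq_zero (𝓕.le n) hM (h.condExp_incr n)
    (hcont.comp_stronglyMeasurable (hy.prodMk hL)) hi

/-- A random sequence whose trajectories follow the recursion of `IsErrorPath`, driven by bounded
martingale noise and started from a square integrable random vector. -/
structure IsErrorSequence (P : Measure Ω) (𝓕 : Filtration ℕ mΩ) (β : ℕ → ℝ) (T : E →L[ℝ] E) (C : ℝ)
    (M H : ℕ → Ω → (E →L[ℝ] E) × E) (e : ℕ → Ω → E) : Prop where
  noise : IsBoundedNoise P 𝓕 C M H
  stronglyMeasurable_zero : StronglyMeasurable[𝓕 0] (e 0)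
  memLp_zero : MemLp (e 0) 2 P
  step : ∀ n ω, e (n + 1) ω
    = e n ω + β n • (T (e n ω) + affineEval (e n ω) (M n ω + (H n ω - H (n + 1) ω)))

namespace IsErrorSequence

variable {P : Measure Ω} {𝓕 : Filtration ℕ mΩ} {β : ℕ → ℝ} {T S : E →L[ℝ] E} {C c : ℝ}
  {M H : ℕ → Ω → (E →L[ℝ] E) × E} {e : ℕ → Ω → E}

lemma ae_isErrorPath (he : IsErrorSequence P 𝓕 β T C M H e) :
    ∀ᵐ ω ∂P, IsErrorPath β T C (M · ω) (H · ω) (e · ω) := by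
  filter_upwards [ae_all_iff.2 he.noise.norm_incr_le, ae_all_iff.2 he.noise.norm_corr_le]
    with ω hM hH
  exact ⟨hM, hH, fun n => he.step n ω⟩

lemma stronglyAdapted (he : IsErrorSequence P 𝓕 β T C M H e) : StronglyAdapted 𝓕 e := by
  intro n
  induction n with
  | zero => exact he.stronglyMeasurable_zero
  | succ n ih =>
    have hen : StronglyMeasurable[𝓕 (n + 1)] (e n) := ih.mono (𝓕.mono n.le_succ)
    have hH : StronglyMeasurable[𝓕 (n + 1)] (H n) :=
      (he.noise.stronglyAdapted_corr n).mono (𝓕.mono n.le_succ)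
    have hnoise := stronglyMeasurable_affineEval hen ((he.noise.stronglyMeasurable_incr n).add
      (hH.sub (he.noise.stronglyAdapted_corr (n + 1))))
    rw [funext (he.step n)]
    exact hen.add (((T.continuous.comp_stronglyMeasurable hen).add hnoise).const_smul (β n))

lemma stronglyMeasurable_correctedError (he : IsErrorSequence P 𝓕 β T C M H e) (n : ℕ) :
    StronglyMeasurable[𝓕 n] fun ω => correctedError β (H · ω) (e · ω) n :=
  (he.stronglyAdapted n).add ((stronglyMeasurable_affineEval (he.stronglyAdapted n)
    (he.noise.stronglyAdapted_corr n)).const_smul (β n))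

lemma aestronglyMeasurable (he : IsErrorSequence P 𝓕 β T C M H e) (n : ℕ) :
    AEStronglyMeasurable (e n) P :=
  ((he.stronglyAdapted n).mono (𝓕.le n)).aestronglyMeasurable

variable [IsProbabilityMeasure P]

lemma memLp (he : IsErrorSequence P 𝓕 β T C M H e) (hβ : ∀ n, 0 ≤ β n) (n : ℕ) :
    MemLp (e n) 2 P := by
  induction n with
  | zero => exact he.memLp_zero
  | succ n ih =>
    exact memLp_of_ae_norm_sub_le_mul_one_add (C := β n * (‖T‖ + 3 * C))
      (he.aestronglyMeasurable (n + 1)) ih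
      (he.ae_isErrorPath.mono fun _ hω => (hω.norm_sub_le (hβ n)).trans_eq (mul_assoc _ _ _).symm)

lemma memLp_affineEval (he : IsErrorSequence P 𝓕 β T C M H e) (hβ : ∀ n, 0 ≤ β n) (n : ℕ) :
    MemLp (fun ω => affineEval (e n ω) (M n ω)) 2 P :=
  memLp_of_ae_norm_le_mul_one_add
    (stronglyMeasurable_affineEval ((he.stronglyAdapted n).mono (𝓕.le n))
      ((he.noise.stronglyMeasurable_incr n).mono (𝓕.le _))).aestronglyMeasurable (he.memLp hβ n)
    ((he.noise.norm_incr_le n).mono fun _ hω => norm_affineEval_le hω _)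

lemma memLp_correctedError (he : IsErrorSequence P 𝓕 β T C M H e) (hβ : ∀ n, 0 ≤ β n) (n : ℕ) :
    MemLp (fun ω => correctedError β (H · ω) (e · ω) n) 2 P :=
  memLp_of_ae_norm_sub_le_mul_one_add (C := β n * C)
    ((he.stronglyMeasurable_correctedError n).mono (𝓕.le n)).aestronglyMeasurable (he.memLp hβ n)
    (he.ae_isErrorPath.mono fun _ hω =>
      (hω.norm_correctedError_sub_le (hβ n)).trans_eq (mul_assoc _ _ _).symm)

variable [CompleteSpace E]

lemma exists_integral_lyapunov_le (he : IsErrorSequence P 𝓕 β T C M H e) (hβ : IsSlowlyDecreasing β)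
    (hS : IsLyapunov T S c) :
    ∃ K, ∀ n, ∫ ω, inner ℝ (S (correctedError β (H · ω) (e · ω) n))
      (correctedError β (H · ω) (e · ω) n) ∂P ≤ K * β n := by
  have hβ0 (n : ℕ) : 0 ≤ β n := (hβ.pos n).le
  have hSx (n : ℕ) : MemLp (fun ω => S (correctedError β (H · ω) (e · ω) n)) 2 P :=
    S.comp_memLp' (he.memLp_correctedError hβ0 n)
  have hV (n : ℕ) := integrable_inner_of_memLp_two (hSx n) (he.memLp_correctedError hβ0 n)
  have hN (n : ℕ) := integrable_inner_of_memLp_two (hSx n) (he.memLp_affineEval hβ0 n)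
  have hzero (n : ℕ) : ∫ ω, inner ℝ (S (correctedError β (H · ω) (e · ω) n))
      (affineEval (e n ω) (M n ω)) ∂P = 0 :=
    he.noise.integral_inner_clm_eq_zero
      (continuous_affineEval.comp_stronglyMeasurable (he.stronglyAdapted n))
      (S.continuous.comp_stronglyMeasurable (he.stronglyMeasurable_correctedError n)) (hN n)
  obtain ⟨K, hK⟩ := hβ.exists_lyapunov_recursion hS C
  refine hβ.exists_le_mul_of_recursion (c := c / (‖S‖ + 1)) (C := K)
    (div_pos hS.pos (by positivity))
    (fun n => integral_nonneg fun ω => (sq_nonneg _).trans (hS.sq_norm_le _)) ?_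
  filter_upwards [hK] with n hn
  have hdrift (a b : ℝ) := ((hV n).const_mul a).fun_add (integrable_const b)
  refine (integral_mono_ae (hV (n + 1)) ((hdrift _ _).fun_add
    ((hN n).const_mul _)) (he.ae_isErrorPath.mono fun ω hω => hn hω)).trans_eq ?_
  rw [integral_add (hdrift _ _) ((hN n).const_mul _),
    integral_add ((hV n).const_mul _) (integrable_const _), integral_const_mul, integral_const,
    integral_const_mul, hzero n]
  simp

lemma exists_lpNorm_correctedError_le (he : IsErrorSequence P 𝓕 β T C M H e)
    (hβ : IsSlowlyDecreasing β) (hS : IsLyapunov T S c) :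
    ∃ K, ∀ n, lpNorm (fun ω => correctedError β (H · ω) (e · ω) n) 2 P ≤ K * √(β n) := by
  obtain ⟨K, hK⟩ := he.exists_integral_lyapunov_le hβ hS
  refine ⟨√K, fun n => ?_⟩
  have hx := he.memLp_correctedError (fun n => (hβ.pos n).le) n
  rw [← Real.sqrt_mul' K (hβ.pos n).le]
  refine Real.le_sqrt_of_sq_le ?_
  rw [lpNorm_two_sq hx.aestronglyMeasurable]
  exact (integral_mono (hx.integrable_norm_pow two_ne_zero)
    (integrable_inner_of_memLp_two (S.comp_memLp' hx) hx) fun ω => hS.sq_norm_le _).trans (hK n)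

end IsErrorSequence

end ErrorSequence

section ErrorAverages

variable {Ω E : Type*} {mΩ : MeasurableSpace Ω} [NormedAddCommGroup E] [InnerProductSpace ℝ E]

lemma lpNorm_sum_inv_smul_sub_le {P : Measure Ω} {β : ℕ → ℝ} {x : ℕ → Ω → E} {K : ℝ}
    (hβ : ∀ n, 0 < β n) (hanti : Antitone β) (hx : ∀ n, MemLp (x n) 2 P)
    (hK : ∀ n, lpNorm (x n) 2 P ≤ K * √(β n)) (t : ℕ) :
    lpNorm (∑ i ∈ Finset.range t, (β i)⁻¹ • (x (i + 1) - x i)) 2 P ≤ 3 * K * (√(β t))⁻¹ := by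
  have hs (n : ℕ) : 0 < √(β n) := Real.sqrt_pos.2 (hβ n)
  have hsq (n : ℕ) : (√(β n))⁻¹ ^ 2 = (β n)⁻¹ := by rw [inv_pow, Real.sq_sqrt (hβ n).le]
  have hK0 : 0 ≤ K := nonneg_of_mul_nonneg_left (lpNorm_nonneg.trans (hK 0)) (hs 0)
  have habel := sum_range_sq_sub_sq_mul_le (s := fun n => (√(β n))⁻¹)
    (fun n => inv_pos.2 (hs n))
    (fun m n h => inv_anti₀ (hs n) (Real.sqrt_le_sqrt (hanti h))) hK0
    (fun n => (inv_mul_le_iff₀ (hs n)).2 ((hK n).trans_eq (mul_comm _ _))) t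
  simp only [hsq] at habel
  exact (lpNorm_sum_range_smul_sub_le one_le_two (fun n => inv_nonneg.2 (hβ n).le)
    (fun m n h => inv_anti₀ (hβ n) (hanti h)) hx t).trans habel

namespace IsErrorSequence

variable {P : Measure Ω} {𝓕 : Filtration ℕ mΩ} {β : ℕ → ℝ} {T S : E →L[ℝ] E} {C c : ℝ}
  {M H : ℕ → Ω → (E →L[ℝ] E) × E} {e : ℕ → Ω → E}

lemma stronglyMeasurable_incr_fst_apply (he : IsErrorSequence P 𝓕 β T C M H e) (n : ℕ) :
    StronglyMeasurable[𝓕 (n + 1)] fun ω => (M n ω).1 (e n ω) :=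
  isBoundedBilinearMap_apply.continuous.comp_stronglyMeasurable
    ((he.noise.stronglyMeasurable_incr n).fst.prodMk
      ((he.stronglyAdapted n).mono (𝓕.mono n.le_succ)))

lemma ae_norm_incr_fst_apply_le (he : IsErrorSequence P 𝓕 β T C M H e) (n : ℕ) :
    ∀ᵐ ω ∂P, ‖(M n ω).1 (e n ω)‖ ≤ C * ‖e n ω‖ :=
  (he.noise.norm_incr_le n).mono fun ω hω =>
    (M n ω).1.le_of_opNorm_le ((norm_fst_le _).trans hω) _

variable [IsProbabilityMeasure P]

lemma bound_nonneg (he : IsErrorSequence P 𝓕 β T C M H e) : 0 ≤ C :=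
  he.ae_isErrorPath.exists.elim fun _ hω => hω.bound_nonneg

lemma lpNorm_le_of_small (he : IsErrorSequence P 𝓕 β T C M H e) (hβ : ∀ n, 0 ≤ β n) {n : ℕ}
    (hβC : β n * C ≤ 1 / 2) :
    lpNorm (e n) 2 P
      ≤ 2 * (lpNorm (fun ω => correctedError β (H · ω) (e · ω) n) 2 P + β n * C) := by
  have hx := he.memLp_correctedError hβ n
  have hcorr : lpNorm ((fun ω => correctedError β (H · ω) (e · ω) n) - e n) 2 P
      ≤ β n * C * (1 + lpNorm (e n) 2 P) :=
    lpNorm_le_mul_one_add one_le_two (mul_nonneg (hβ n) he.bound_nonneg)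
      (hx.sub (he.memLp hβ n)).aestronglyMeasurable (he.memLp hβ n)
      (he.ae_isErrorPath.mono fun _ hω =>
        (hω.norm_correctedError_sub_le (hβ n)).trans_eq (mul_assoc _ _ _).symm)
  have htriangle := lpNorm_le_lpNorm_add_lpNorm_sub (f := e n) hx one_le_two
  nlinarith [mul_le_mul_of_nonneg_right hβC (lpNorm_nonneg (f := e n) (p := 2) (μ := P))]

theorem exists_lpNorm_le [CompleteSpace E] (he : IsErrorSequence P 𝓕 β T C M H e)
    (hβ : IsSlowlyDecreasing β) (hS : IsLyapunov T S c) :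
    ∃ K, ∀ n, lpNorm (e n) 2 P ≤ K * √(β n) := by
  obtain ⟨K, hK⟩ := he.exists_lpNorm_correctedError_le hβ hS
  have hbigO : (fun n => lpNorm (e n) 2 P) =O[atTop] fun n => √(β n) := by
    refine Asymptotics.IsBigO.of_bound (2 * (K + C)) ?_
    filter_upwards [(hβ.tendsto_zero.mul_const C).eventually_le_const (u := 1 / 2) (by simp),
      hβ.tendsto_zero.eventually_le_const one_pos] with n hβC hβ1
    rw [Real.norm_of_nonneg lpNorm_nonneg, Real.norm_of_nonneg (Real.sqrt_nonneg _)]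
    have hsqrt : β n ≤ √(β n) := Real.le_sqrt_of_sq_le (by nlinarith [hβ.pos n])
    nlinarith [he.lpNorm_le_of_small (fun n => (hβ.pos n).le) hβC, hK n,
      mul_le_mul_of_nonneg_right hsqrt he.bound_nonneg]
  obtain ⟨K', -, hK'⟩ := Asymptotics.bound_of_isBigO_nat_atTop hbigO
  refine ⟨K', fun n => ?_⟩
  simpa only [Real.norm_of_nonneg lpNorm_nonneg, Real.norm_of_nonneg (Real.sqrt_nonneg _)]
    using hK' (Real.sqrt_pos.2 (hβ.pos n)).ne'

lemma memLp_incr_fst_apply (he : IsErrorSequence P 𝓕 β T C M H e) (hβ : ∀ n, 0 ≤ β n) (n : ℕ) :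
    MemLp (fun ω => (M n ω).1 (e n ω)) 2 P :=
  (he.memLp hβ n).of_le_mul
    ((he.stronglyMeasurable_incr_fst_apply n).mono (𝓕.le _)).aestronglyMeasurable
    (he.ae_norm_incr_fst_apply_le n)

lemma integral_inner_sum_incr_eq_zero [CompleteSpace E] (he : IsErrorSequence P 𝓕 β T C M H e)
    (hβ : ∀ n, 0 ≤ β n) (n : ℕ) :
    ∫ ω, inner ℝ ((∑ i ∈ Finset.range n, fun ω => (M i ω).1 (e i ω)) ω) ((M n ω).1 (e n ω)) ∂P
      = 0 := by
  have hcont : Continuous fun u : E =>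
      ContinuousLinearMap.apply ℝ E u ∘L ContinuousLinearMap.fst ℝ (E →L[ℝ] E) E := by fun_prop
  have hpast : StronglyMeasurable[𝓕 n] (∑ i ∈ Finset.range n, fun ω => (M i ω).1 (e i ω)) :=
    Finset.stronglyMeasurable_sum _ fun i hi =>
      (he.stronglyMeasurable_incr_fst_apply i).mono (𝓕.mono (Finset.mem_range.1 hi))
  exact he.noise.integral_inner_clm_eq_zero (hcont.comp_stronglyMeasurable (he.stronglyAdapted n))
    hpast (integrable_inner_of_memLp_two
      (memLp_finsetSum' _ fun i _ => he.memLp_incr_fst_apply hβ i) (he.memLp_incr_fst_apply hβ n))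

lemma sq_lpNorm_sum_incr_le [CompleteSpace E] (he : IsErrorSequence P 𝓕 β T C M H e)
    (hβ : ∀ n, 0 ≤ β n) (t : ℕ) :
    lpNorm (∑ i ∈ Finset.range t, fun ω => (M i ω).1 (e i ω)) 2 P ^ 2
      ≤ C ^ 2 * ∑ i ∈ Finset.range t, lpNorm (e i) 2 P ^ 2 := by
  rw [lpNorm_two_sum_range_sq_of_integral_inner_eq_zero (he.memLp_incr_fst_apply hβ)
    (he.integral_inner_sum_incr_eq_zero hβ), Finset.mul_sum]
  gcongr with i
  rw [← mul_pow]
  refine pow_le_pow_left₀ lpNorm_nonneg ?_ 2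
  exact lpNorm_le_mul_lpNorm he.bound_nonneg (he.memLp_incr_fst_apply hβ i).aestronglyMeasurable
    (he.memLp hβ i) (he.ae_norm_incr_fst_apply_le i)

lemma memLp_correctionRemainder (he : IsErrorSequence P 𝓕 β T C M H e) (hβ : ∀ n, 0 ≤ β n)
    (n : ℕ) : MemLp (fun ω => correctionRemainder β (H · ω) (e · ω) n) 2 P := by
  have hterm (k : ℕ) : MemLp (fun ω => affineEval (e k ω) (H (n + 1) ω)) 2 P :=
    memLp_of_ae_norm_le_mul_one_add
      (stronglyMeasurable_affineEval ((he.stronglyAdapted k).mono (𝓕.le k))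
        ((he.noise.stronglyAdapted_corr (n + 1)).mono (𝓕.le _))).aestronglyMeasurable
      (he.memLp hβ k) ((he.noise.norm_corr_le (n + 1)).mono fun _ hω => norm_affineEval_le hω _)
  exact ((hterm (n + 1)).const_smul _).sub ((hterm n).const_smul _)

lemma exists_lpNorm_inv_smul_correctionRemainder_le [CompleteSpace E]
    (he : IsErrorSequence P 𝓕 β T C M H e) (hβ : IsSlowlyDecreasing β) (hS : IsLyapunov T S c) :
    ∃ R, ∀ n, lpNorm (fun ω => (β n)⁻¹ • correctionRemainder β (H · ω) (e · ω) n) 2 P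
      ≤ R * β n := by
  have hβ0 (n : ℕ) : 0 ≤ β n := (hβ.pos n).le
  have hC := he.bound_nonneg
  obtain ⟨D, hD⟩ := hβ.exists_sub_succ_le
  have hD0 : 0 ≤ D := nonneg_of_mul_nonneg_left
    ((sub_nonneg.2 (hβ.antitone (Nat.le_succ 0))).trans (hD 0)) (pow_pos (hβ.pos 0) 2)
  obtain ⟨K, hK⟩ := he.exists_lpNorm_le hβ hS
  have hK0 : 0 ≤ K := nonneg_of_mul_nonneg_left (lpNorm_nonneg.trans (hK 0))
    (Real.sqrt_pos.2 (hβ.pos 0))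
  refine ⟨C * (‖T‖ + 3 * C + D) * (1 + K * √(β 0)), fun n => ?_⟩
  have hrem := (he.memLp_correctionRemainder hβ0 n).const_smul (β n)⁻¹
  have hbound : ∀ᵐ ω ∂P, ‖(β n)⁻¹ • correctionRemainder β (H · ω) (e · ω) n‖
      ≤ C * (‖T‖ + 3 * C + D) * β n * (1 + ‖e n ω‖) := by
    filter_upwards [he.ae_isErrorPath] with ω hω
    rw [norm_smul, norm_inv, Real.norm_of_nonneg (hβ0 n), inv_mul_le_iff₀ (hβ.pos n)]
    exact (hω.norm_correctionRemainder_le (hβ0 _) (hβ.antitone n.le_succ) (hD n)).trans_eq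
      (by ring)
  refine (lpNorm_le_mul_one_add one_le_two (mul_nonneg (by positivity) (hβ0 n))
    hrem.aestronglyMeasurable (he.memLp hβ0 n) hbound).trans ?_
  rw [mul_right_comm]
  have hmono : √(β n) ≤ √(β 0) := Real.sqrt_le_sqrt (hβ.antitone n.zero_le)
  have := hβ0 n
  gcongr
  exact (hK n).trans (by gcongr)

end IsErrorSequence

end ErrorAverages

section AveragedError

lemma isLittleO_sqrt_of_nonneg_of_le {f g : ℕ → ℝ} (hf : ∀ t, 0 ≤ f t) (hfg : ∀ t, f t ≤ g t)
    (hg : g =o[atTop] fun t : ℕ => √(t : ℝ)) : f =o[atTop] fun t : ℕ => √(t : ℝ) :=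
  (Asymptotics.IsBigO.of_norm_le fun t => by
    rw [Real.norm_of_nonneg (hf t)]
    exact hfg t).trans_isLittleO hg

lemma isLittleO_const_sqrt (c : ℝ) : (fun _ : ℕ => c) =o[atTop] fun t : ℕ => √(t : ℝ) :=
  Asymptotics.isLittleO_const_left.2 <| Or.inr <| tendsto_norm_atTop_atTop.comp <|
    Real.tendsto_sqrt_atTop.comp tendsto_natCast_atTop_atTop

namespace IsErrorSequence

variable {Ω E : Type*} {mΩ : MeasurableSpace Ω} [NormedAddCommGroup E] [InnerProductSpace ℝ E]
  {P : Measure Ω} {𝓕 : Filtration ℕ mΩ} {β : ℕ → ℝ} {T S : E →L[ℝ] E}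
  {C c : ℝ} {M H : ℕ → Ω → (E →L[ℝ] E) × E} {e : ℕ → Ω → E}

lemma sum_range_linear_ae_eq (he : IsErrorSequence P 𝓕 β T C M H e) (hβ : ∀ n, β n ≠ 0) (t : ℕ) :
    ∑ i ∈ Finset.range t, (β i)⁻¹ • ((fun ω => correctedError β (H · ω) (e · ω) (i + 1))
        - fun ω => correctedError β (H · ω) (e · ω) i)
      - ∑ i ∈ Finset.range t, (fun ω => (M i ω).1 (e i ω))
      - ∑ i ∈ Finset.range t, (fun ω => (β i)⁻¹ • correctionRemainder β (H · ω) (e · ω) i)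
      + (fun ω => (H 0 ω - H t ω).2)
    =ᵐ[P] fun ω => ∑ i ∈ Finset.range t, (T (e i ω) + (M i ω + (H i ω - H (i + 1) ω)).2) := by
  filter_upwards [he.ae_isErrorPath] with ω hω
  rw [hω.sum_range_linear_eq hβ]
  simp only [Pi.add_apply, Pi.sub_apply, Finset.sum_apply, Pi.smul_apply]

variable [IsProbabilityMeasure P]

lemma memLp_and_lpNorm_corr_snd_sub_le (he : IsErrorSequence P 𝓕 β T C M H e) (t : ℕ) :
    MemLp (fun ω => (H 0 ω - H t ω).2) 2 P ∧ lpNorm (fun ω => (H 0 ω - H t ω).2) 2 P ≤ 2 * C := by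
  have hmeas (n : ℕ) : AEStronglyMeasurable (H n) P :=
    ((he.noise.stronglyAdapted_corr n).mono (𝓕.le n)).aestronglyMeasurable
  have hsnd : AEStronglyMeasurable (fun ω => (H 0 ω - H t ω).2) P :=
    continuous_snd.comp_aestronglyMeasurable ((hmeas 0).sub (hmeas t))
  have hbound : ∀ᵐ ω ∂P, ‖(H 0 ω - H t ω).2‖ ≤ 2 * C := by
    filter_upwards [he.noise.norm_corr_le 0, he.noise.norm_corr_le t] with ω h0 ht
    rw [two_mul]
    exact (norm_snd_le _).trans (norm_sub_le_of_le h0 ht)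
  exact ⟨.of_bound hsnd _ hbound, lpNorm_le_of_ae_norm_le_const hsnd two_ne_zero
    (mul_nonneg two_pos.le he.bound_nonneg) hbound⟩

variable [CompleteSpace E]

lemma isLittleO_lpNorm_sum_inv_smul_correctedError_sub (he : IsErrorSequence P 𝓕 β T C M H e)
    (hβ : IsSlowlyDecreasing β) (hS : IsLyapunov T S c) :
    (fun t => lpNorm (∑ i ∈ Finset.range t, (β i)⁻¹ •
        ((fun ω => correctedError β (H · ω) (e · ω) (i + 1))
          - fun ω => correctedError β (H · ω) (e · ω) i)) 2 P) =o[atTop] fun t : ℕ => √(t : ℝ) := by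
  obtain ⟨K, hK⟩ := he.exists_lpNorm_correctedError_le hβ hS
  exact isLittleO_sqrt_of_nonneg_of_le (g := fun t => 3 * K * (√(β t))⁻¹)
    (fun _ => lpNorm_nonneg)
    (lpNorm_sum_inv_smul_sub_le (x := fun i ω => correctedError β (H · ω) (e · ω) i) hβ.pos
      hβ.antitone (he.memLp_correctedError fun n => (hβ.pos n).le) hK)
    (hβ.isLittleO_inv_sqrt.const_mul_left _)

lemma isLittleO_lpNorm_sum_incr (he : IsErrorSequence P 𝓕 β T C M H e)
    (hβ : IsSlowlyDecreasing β) (hS : IsLyapunov T S c) :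
    (fun t => lpNorm (∑ i ∈ Finset.range t, fun ω => (M i ω).1 (e i ω)) 2 P)
      =o[atTop] fun t : ℕ => √(t : ℝ) := by
  obtain ⟨K, hK⟩ := he.exists_lpNorm_le hβ hS
  have hsq (i : ℕ) : lpNorm (e i) 2 P ^ 2 ≤ K ^ 2 * β i := by
    rw [← Real.sq_sqrt (hβ.pos i).le, ← mul_pow]
    exact pow_le_pow_left₀ lpNorm_nonneg (hK i) 2
  refine isLittleO_sqrt_of_nonneg_of_le
    (g := fun t => C ^ 2 * K ^ 2 * ∑ i ∈ Finset.range t, β i + 1) (fun _ => lpNorm_nonneg)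
    (fun t => ?_) ((hβ.sum_isLittleO.const_mul_left _).add (isLittleO_const_sqrt 1))
  have hsum : lpNorm (∑ i ∈ Finset.range t, fun ω => (M i ω).1 (e i ω)) 2 P ^ 2
      ≤ C ^ 2 * K ^ 2 * ∑ i ∈ Finset.range t, β i :=
    calc _ ≤ C ^ 2 * ∑ i ∈ Finset.range t, lpNorm (e i) 2 P ^ 2 :=
          he.sq_lpNorm_sum_incr_le (fun n => (hβ.pos n).le) t
      _ ≤ C ^ 2 * ∑ i ∈ Finset.range t, K ^ 2 * β i := by
          gcongr with i
          exact hsq i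
      _ = C ^ 2 * K ^ 2 * ∑ i ∈ Finset.range t, β i := by rw [← Finset.mul_sum, mul_assoc]
  nlinarith [sq_nonneg (lpNorm (∑ i ∈ Finset.range t, fun ω => (M i ω).1 (e i ω)) 2 P - 1)]

lemma isLittleO_lpNorm_sum_inv_smul_correctionRemainder (he : IsErrorSequence P 𝓕 β T C M H e)
    (hβ : IsSlowlyDecreasing β) (hS : IsLyapunov T S c) :
    (fun t => lpNorm (∑ i ∈ Finset.range t, fun ω =>
        (β i)⁻¹ • correctionRemainder β (H · ω) (e · ω) i) 2 P)
      =o[atTop] fun t : ℕ => √(t : ℝ) := by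
  obtain ⟨R, hR⟩ := he.exists_lpNorm_inv_smul_correctionRemainder_le hβ hS
  refine isLittleO_sqrt_of_nonneg_of_le (fun _ => lpNorm_nonneg) (fun t => ?_)
    (hβ.sum_isLittleO.const_mul_left R)
  rw [Finset.mul_sum]
  exact (lpNorm_sum_le (fun i _ => (he.memLp_correctionRemainder (fun n => (hβ.pos n).le)
    i).const_smul _) one_le_two).trans (Finset.sum_le_sum fun i _ => hR i)

theorem memLp_and_isLittleO_lpNorm_sum_linear (he : IsErrorSequence P 𝓕 β T C M H e)
    (hβ : IsSlowlyDecreasing β) (hS : IsLyapunov T S c) :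
    (∀ t, MemLp (fun ω => ∑ i ∈ Finset.range t,
      (T (e i ω) + (M i ω + (H i ω - H (i + 1) ω)).2)) 2 P) ∧
    (fun t => lpNorm (fun ω => ∑ i ∈ Finset.range t,
      (T (e i ω) + (M i ω + (H i ω - H (i + 1) ω)).2)) 2 P) =o[atTop] fun t : ℕ => √(t : ℝ) := by
  have hβ0 (n : ℕ) : 0 ≤ β n := (hβ.pos n).le
  set D : ℕ → Ω → E := fun t => ∑ i ∈ Finset.range t, (β i)⁻¹ •
    ((fun ω => correctedError β (H · ω) (e · ω) (i + 1))
      - fun ω => correctedError β (H · ω) (e · ω) i)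
  set N : ℕ → Ω → E := fun t => ∑ i ∈ Finset.range t, fun ω => (M i ω).1 (e i ω)
  set R : ℕ → Ω → E := fun t =>
    ∑ i ∈ Finset.range t, fun ω => (β i)⁻¹ • correctionRemainder β (H · ω) (e · ω) i
  set G : ℕ → Ω → E := fun t ω => (H 0 ω - H t ω).2
  have hD (t : ℕ) : MemLp (D t) 2 P := memLp_finsetSum' _ fun i _ =>
    ((he.memLp_correctedError hβ0 (i + 1)).sub (he.memLp_correctedError hβ0 i)).const_smul _
  have hN (t : ℕ) : MemLp (N t) 2 P := memLp_finsetSum' _ fun i _ => he.memLp_incr_fst_apply hβ0 i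
  have hR (t : ℕ) : MemLp (R t) 2 P :=
    memLp_finsetSum' _ fun i _ => (he.memLp_correctionRemainder hβ0 i).const_smul _
  have hG (t : ℕ) := he.memLp_and_lpNorm_corr_snd_sub_le t
  have hDNR (t : ℕ) : MemLp (D t - N t - R t) 2 P := ((hD t).sub (hN t)).sub (hR t)
  have hmem (t : ℕ) : MemLp (D t - N t - R t + G t) 2 P := (hDNR t).add (hG t).1
  have hsum := he.sum_range_linear_ae_eq fun n => (hβ.pos n).ne'
  refine ⟨fun t => (memLp_congr_ae (hsum t)).1 (hmem t),
    isLittleO_sqrt_of_nonneg_of_le (fun _ => lpNorm_nonneg) (fun t => ?_)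
    (((he.isLittleO_lpNorm_sum_inv_smul_correctedError_sub hβ hS).add
      (he.isLittleO_lpNorm_sum_incr hβ hS)).add
      (he.isLittleO_lpNorm_sum_inv_smul_correctionRemainder hβ hS) |>.add
      (isLittleO_const_sqrt (2 * C)))⟩
  rw [← lpNorm_congr_ae (hmem t).aestronglyMeasurable (hsum t)]
  have hadd := lpNorm_add_le (hDNR t) one_le_two (g := G t)
  have hsubR := lpNorm_sub_le ((hD t).sub (hN t)) one_le_two (g := R t)
  have hsubN := lpNorm_sub_le (hD t) one_le_two (g := N t)
  linarith [(hG t).2]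

theorem tendstoInMeasure_inv_sqrt_smul_sum (he : IsErrorSequence P 𝓕 β T C M H e)
    (hβ : IsSlowlyDecreasing β) (hS : IsLyapunov T S c) :
    TendstoInMeasure P (fun (t : ℕ) ω => (√(t : ℝ))⁻¹ • ∑ i ∈ Finset.range t,
      (T (e i ω) + (M i ω + (H i ω - H (i + 1) ω)).2)) atTop fun _ => 0 :=
  have ⟨hmem, hlittle⟩ := he.memLp_and_isLittleO_lpNorm_sum_linear hβ hS
  tendstoInMeasure_inv_smul_of_isLittleO_lpNorm two_ne_zero hmem hlittle

end IsErrorSequence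

end AveragedError

section MarkovDrivenRecursion

lemma sum_Icc_one_eq_sum_range {F : Type*} [AddCommMonoid F] (f : ℕ → F) (t : ℕ) :
    ∑ i ∈ Finset.Icc 1 t, f i = ∑ i ∈ Finset.range t, f (i + 1) := by
  rw [← Finset.Ico_add_one_right_eq_Icc, Finset.sum_Ico_eq_sum_range, Nat.add_sub_cancel]
  exact Finset.sum_congr rfl fun i _ => by rw [add_comm]

variable {Ω S E : Type*} {mΩ : MeasurableSpace Ω} [MeasurableSpace S] [NormedAddCommGroup E]
  [InnerProductSpace ℝ E] {P : Measure Ω} [IsProbabilityMeasure P] {κ : Kernel S S}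
  [IsMarkovKernel κ] {μ : Measure S} [IsProbabilityMeasure μ] {X : ℕ → Ω → S} {W : ℕ → Ω → ℝ}
  {f : S → (E →L[ℝ] E) × E} {K : ℝ} {α : ℕ → ℝ} {e : ℕ → Ω → E} {u : E}

lemma stronglyMeasurable_and_memLp_first_iterate (hX : ∀ t, 1 ≤ t → Measurable (X t))
    (hW : IsMeanOneWeights P X W) (hf : StronglyMeasurable f) (hK : ∀ x, ‖f x‖ ≤ K) (a : ℝ) :
    StronglyMeasurable[jointFiltration hX hW.measurable 0]
      (fun ω => u + a • affineEval u (W 1 ω • f (X 1 ω))) ∧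
    MemLp (fun ω => u + a • affineEval u (W 1 ω • f (X 1 ω))) 2 P := by
  have hWf : StronglyMeasurable[jointFiltration hX hW.measurable 0] fun ω => W 1 ω • f (X 1 ω) :=
    (measurable_jointFiltration_right hX hW.measurable 0).stronglyMeasurable.smul
      (hf.comp_measurable (measurable_jointFiltration_left hX hW.measurable 0))
  have hmeas := ((affineEval u).continuous.comp_stronglyMeasurable hWf).const_smul a
  obtain ⟨B, hB⟩ := hW.bounded
  have hbound : ∀ᵐ ω ∂P, ‖W 1 ω • f (X 1 ω)‖ ≤ B * K := (hB 1 le_rfl).mono fun ω hω => by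
    rw [norm_smul]
    exact mul_le_mul hω (hK _) (norm_nonneg _) ((abs_nonneg _).trans hω)
  have hmem : MemLp (fun ω => W 1 ω • f (X 1 ω)) 2 P :=
    .of_bound (hWf.mono (Filtration.le _ 0)).aestronglyMeasurable _ hbound
  exact ⟨stronglyMeasurable_const.add hmeas,
    (memLp_const u).add (((affineEval u).comp_memLp' hmem).const_smul a)⟩

theorem exists_isErrorSequence [CompleteSpace E] {T : E →L[ℝ] E} (hκ : UniformlyErgodic κ μ)
    (hX : IsMarkovChain P κ X) (hW : IsMeanOneWeights P X W) (hf : StronglyMeasurable f)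
    (hK : ∀ x, ‖f x‖ ≤ K) (hmean : ∫ x, f x ∂μ = (T, 0)) (he0 : ∀ ω, e 0 ω = u)
    (hstep : ∀ t ω, e (t + 1) ω
      = e t ω + α (t + 1) • affineEval (e t ω) (W (t + 1) ω • f (X (t + 1) ω))) :
    ∃ (C : ℝ) (M H : ℕ → Ω → (E →L[ℝ] E) × E),
      IsErrorSequence P (jointFiltration hX.measurable hW.measurable) (fun n => α (n + 2)) T C M H
        (fun n => e (n + 1)) ∧
      ∀ n ω, W (n + 2) ω • f (X (n + 2) ω) = (T, 0) + (M n ω + (H n ω - H (n + 1) ω)) := by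
  obtain ⟨C, M, H, hnoise, hdecomp⟩ := exists_noise_decomposition hκ hX hW hf hK
  simp only [hmean, add_assoc] at hdecomp
  have hfirst : e 1 = fun ω => u + α 1 • affineEval u (W 1 ω • f (X 1 ω)) :=
    funext fun ω => by rw [hstep 0 ω, he0]
  obtain ⟨hmeas, hmem⟩ :=
    stronglyMeasurable_and_memLp_first_iterate (u := u) hX.measurable hW hf hK (α 1)
  refine ⟨C, M, H, ⟨hnoise, hfirst ▸ hmeas, hfirst ▸ hmem, fun n ω => ?_⟩, hdecomp⟩
  rw [hstep, hdecomp, map_add (affineEval _), affineEval_apply _ (T, 0), add_zero]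

theorem tendstoInMeasure_inv_sqrt_smul_sum_linear [CompleteSpace E] {T Q : E →L[ℝ] E} {c : ℝ}
    (hQ : IsLyapunov T Q c) (hα : IsSlowlyDecreasing fun n => α (n + 1))
    (hκ : UniformlyErgodic κ μ) (hX : IsMarkovChain P κ X) (hW : IsMeanOneWeights P X W)
    (hf : StronglyMeasurable f) (hK : ∀ x, ‖f x‖ ≤ K) (hmean : ∫ x, f x ∂μ = (T, 0))
    (he0 : ∀ ω, e 0 ω = u)
    (hstep : ∀ t ω, e (t + 1) ω
      = e t ω + α (t + 1) • affineEval (e t ω) (W (t + 1) ω • f (X (t + 1) ω))) :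
    TendstoInMeasure P (fun (t : ℕ) ω => (√(t : ℝ))⁻¹ • ∑ i ∈ Finset.Icc 1 t,
      (T (e i ω) + W (i + 1) ω • (f (X (i + 1) ω)).2)) atTop fun _ => 0 := by
  obtain ⟨C, M, H, he, hdecomp⟩ := exists_isErrorSequence hκ hX hW hf hK hmean he0 hstep
  have hlinear (n : ℕ) (ω : Ω) :
      W (n + 2) ω • (f (X (n + 2) ω)).2 = (M n ω + (H n ω - H (n + 1) ω)).2 := by
    rw [← Prod.smul_snd, hdecomp, Prod.snd_add, zero_add]
  simpa only [sum_Icc_one_eq_sum_range, add_assoc, one_add_one_eq_two, hlinear] using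
    he.tendstoInMeasure_inv_sqrt_smul_sum hα.succ hQ

end MarkovDrivenRecursion

section LittleOp

variable {Ω : Type*} {mΩ : MeasurableSpace Ω} {P : Measure Ω}

lemma tendstoInMeasure_clm_comp {F G : Type*} [SeminormedAddCommGroup F] [NormedSpace ℝ F]
    [SeminormedAddCommGroup G] [NormedSpace ℝ G] {f : ℕ → Ω → F}
    (hf : TendstoInMeasure P f atTop fun _ => 0) (L : F →L[ℝ] G) :
    TendstoInMeasure P (fun n ω => L (f n ω)) atTop fun _ => 0 := by
  rw [tendstoInMeasure_iff_norm] at hf ⊢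
  intro ε hε
  have hL : 0 < ‖L‖ + 1 := by positivity
  refine tendsto_of_tendsto_of_tendsto_of_le_of_le tendsto_const_nhds
    (hf (ε / (‖L‖ + 1)) (by positivity)) (fun _ => zero_le) fun n => measure_mono fun ω hω => ?_
  simp only [sub_zero, Set.mem_ofPred_eq] at hω ⊢
  rw [div_le_iff₀' hL]
  exact hω.trans (L.le_of_opNorm_le (le_add_of_nonneg_right zero_le_one) _)

lemma EqUpToLittleOp.sub {d : ℕ} {U V U' V' : ℕ → Ω → EuclideanSpace ℝ (Fin d)}
    (h : EqUpToLittleOp P U V) (h' : EqUpToLittleOp P U' V') :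
    EqUpToLittleOp P (fun t ω => U t ω - U' t ω) (fun t ω => V t ω - V' t ω) := by
  intro ε hε
  have hε2 : 0 < ε / 2 := ENNReal.half_pos hε.ne'
  have hsum := (h _ hε2).add (h' _ hε2)
  rw [add_zero] at hsum
  refine tendsto_of_tendsto_of_tendsto_of_le_of_le tendsto_const_nhds hsum (fun _ => zero_le)
    fun t => (measure_mono fun ω hω => ?_).trans (measure_union_le _ _)
  by_contra hsmall
  simp only [Set.mem_union, Set.mem_ofPred_eq, not_or, not_le, edist_zero_right] at hsmall hω
  refine hω.not_gt ?_
  calc ‖U t ω - U' t ω - (V t ω - V' t ω)‖ₑ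
      = ‖(U t ω - V t ω) - (U' t ω - V' t ω)‖ₑ := by rw [sub_sub_sub_comm]
    _ ≤ ‖U t ω - V t ω‖ₑ + ‖U' t ω - V' t ω‖ₑ := enorm_sub_le
    _ < ε / 2 + ε / 2 := ENNReal.add_lt_add hsmall.1 hsmall.2
    _ = ε := ENNReal.add_halves ε

end LittleOp

section Iterates

variable {d : ℕ}

lemma lsa_eq_plsa (α : ℕ → ℝ) (A : ℕ → Matrix (Fin d) (Fin d) ℝ)
    (b : ℕ → EuclideanSpace ℝ (Fin d)) (θ₀ : EuclideanSpace ℝ (Fin d)) :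
    lsa α A b θ₀ = plsa α (fun _ => 1) A b θ₀ := by
  funext t
  induction t with
  | zero => rfl
  | succ t ih => simp only [lsa, plsa, ih, mul_one]

lemma linearTerm_sub (Abar : Matrix (Fin d) (Fin d) ℝ) (c c' : ℕ → ℝ)
    (A : ℕ → Matrix (Fin d) (Fin d) ℝ) (b : ℕ → EuclideanSpace ℝ (Fin d))
    (θ : EuclideanSpace ℝ (Fin d)) (t : ℕ) :
    linearTerm Abar (fun n => c n - c' n) A b θ t
      = linearTerm Abar c A b θ t - linearTerm Abar c' A b θ t := by
  simp only [linearTerm, sub_smul, Finset.sum_sub_distrib, map_sub, smul_sub]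
  abel

lemma sqrt_smul_average_sub_eq (θ : ℕ → EuclideanSpace ℝ (Fin d))
    (θs : EuclideanSpace ℝ (Fin d)) (t : ℕ) :
    √(t : ℝ) • (average θ t - θs) = (√(t : ℝ))⁻¹ • ∑ i ∈ Finset.Icc 1 t, (θ i - θs) := by
  rcases t.eq_zero_or_pos with rfl | ht
  · simp
  have ht' : (t : ℝ) ≠ 0 := by positivity
  have hsum : ∑ i ∈ Finset.Icc 1 t, (θ i - θs) = (t : ℝ) • (average θ t - θs) := by
    rw [average, smul_sub, smul_inv_smul₀ ht', Finset.sum_sub_distrib, Finset.sum_const,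
      Nat.card_Icc, Nat.add_sub_cancel, Nat.cast_smul_eq_nsmul]
  rw [hsum, smul_smul, inv_mul_eq_div, Real.div_sqrt]

lemma IsHurwitz.isUnit_det {A : Matrix (Fin d) (Fin d) ℝ} (hA : IsHurwitz A) :
    IsUnit A.det := by
  have hunit : IsUnit (A.map (algebraMap ℝ ℂ)) :=
    (spectrum.zero_notMem_iff ℂ).1 fun h0 => (hA.re_neg_of_mem_spectrum h0).ne Complex.zero_re
  rw [Matrix.isUnit_iff_isUnit_det, ← RingHom.mapMatrix_apply, ← RingHom.map_det] at hunit
  exact (isUnit_map_iff _ _).1 hunit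

lemma sqrt_smul_average_sub_sub_linearTerm {Abar : Matrix (Fin d) (Fin d) ℝ}
    (hdet : IsUnit Abar.det) (θ : ℕ → EuclideanSpace ℝ (Fin d)) (c : ℕ → ℝ)
    (A : ℕ → Matrix (Fin d) (Fin d) ℝ) (b : ℕ → EuclideanSpace ℝ (Fin d))
    (θs : EuclideanSpace ℝ (Fin d)) (t : ℕ) :
    √(t : ℝ) • (average θ t - θs) - linearTerm Abar c A b θs t
      = Matrix.toEuclideanCLM (𝕜 := ℝ) Abar⁻¹ ((√(t : ℝ))⁻¹ • ∑ i ∈ Finset.Icc 1 t,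
        (Matrix.toEuclideanCLM (𝕜 := ℝ) Abar (θ i - θs)
          + c (i + 1) • (Matrix.toEuclideanCLM (𝕜 := ℝ) (A (i + 1)) θs - b (i + 1)))) := by
  have hinv (u : EuclideanSpace ℝ (Fin d)) :
      Matrix.toEuclideanCLM (𝕜 := ℝ) Abar⁻¹ (Matrix.toEuclideanCLM (𝕜 := ℝ) Abar u) = u := by
    rw [← mul_apply_eq_comp, ← map_mul, Matrix.nonsing_inv_mul _ hdet, map_one, one_apply_eq_self]
  have hinv_sum : Matrix.toEuclideanCLM (𝕜 := ℝ) Abar⁻¹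
      (∑ i ∈ Finset.Icc 1 t, Matrix.toEuclideanCLM (𝕜 := ℝ) Abar (θ i - θs))
      = ∑ i ∈ Finset.Icc 1 t, (θ i - θs) := by
    rw [map_sum]
    exact Finset.sum_congr rfl fun i _ => hinv (θ i - θs)
  rw [sqrt_smul_average_sub_eq, linearTerm, sub_neg_eq_add, ← smul_add, map_smul,
    Finset.sum_add_distrib, map_add, hinv_sum]
  rfl

end Iterates

section Residual

/-- The pair encoding the affine map `u ↦ p.1 (v + u) - p.2`. At `v = θs` and `p = (A, b)` this
map drives the error `u = θ - θs` of linear stochastic approximation. -/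
noncomputable def residualAt {E : Type*} [NormedAddCommGroup E] [NormedSpace ℝ E] (v : E) :
    (E →L[ℝ] E) × E →L[ℝ] (E →L[ℝ] E) × E :=
  (ContinuousLinearMap.fst ℝ _ _).prod
    (ContinuousLinearMap.apply ℝ E v ∘L ContinuousLinearMap.fst ℝ _ _
      - ContinuousLinearMap.snd ℝ _ _)

lemma residualAt_apply {E : Type*} [NormedAddCommGroup E] [NormedSpace ℝ E] (v : E)
    (p : (E →L[ℝ] E) × E) : residualAt v p = (p.1, p.1 v - p.2) := rfl

variable {d : ℕ}

lemma plsa_succ_sub (α w : ℕ → ℝ) (A : ℕ → Matrix (Fin d) (Fin d) ℝ)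
    (b : ℕ → EuclideanSpace ℝ (Fin d)) (θ₀ v : EuclideanSpace ℝ (Fin d)) (t : ℕ) :
    plsa α w A b θ₀ (t + 1) - v = plsa α w A b θ₀ t - v + α (t + 1) •
      affineEval (plsa α w A b θ₀ t - v)
        (w (t + 1) • residualAt v (Matrix.toEuclideanCLM (𝕜 := ℝ) (A (t + 1)), b (t + 1))) := by
  rw [plsa, map_smul, affineEval_apply, residualAt_apply, map_sub,
    ← Matrix.coe_toEuclideanCLM_eq_toEuclideanLin, ContinuousLinearMap.coe_coe]
  module

lemma norm_entry_le_frobenius (A : Matrix (Fin d) (Fin d) ℝ) (i j : Fin d) : ‖A i j‖ ≤ ‖A‖ := by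
  rw [Matrix.frobenius_norm_def, ← Real.sqrt_eq_rpow]
  refine Real.le_sqrt_of_sq_le ?_
  simp_rw [Real.rpow_two]
  calc ‖A i j‖ ^ 2 ≤ ∑ l, ‖A i l‖ ^ 2 :=
        Finset.single_le_sum (f := fun l => ‖A i l‖ ^ 2) (fun _ _ => by positivity)
          (Finset.mem_univ j)
    _ ≤ ∑ k, ∑ l, ‖A k l‖ ^ 2 :=
        Finset.single_le_sum (f := fun k => ∑ l, ‖A k l‖ ^ 2) (fun _ _ => by positivity)
          (Finset.mem_univ i)

lemma norm_toEuclideanCLM_le_frobenius (A : Matrix (Fin d) (Fin d) ℝ) :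
    ‖Matrix.toEuclideanCLM (n := Fin d) (𝕜 := ℝ) A‖ ≤ ‖A‖ := by
  refine ContinuousLinearMap.opNorm_le_bound _ (norm_nonneg A) fun v => ?_
  have hmul := Matrix.frobenius_norm_mul A (Matrix.replicateCol Unit v.ofLp)
  rwa [← Matrix.replicateCol_mulVec, Matrix.frobenius_norm_replicateCol,
    Matrix.frobenius_norm_replicateCol] at hmul

lemma toEuclideanCLM_eq_sum (A : Matrix (Fin d) (Fin d) ℝ) :
    Matrix.toEuclideanCLM (n := Fin d) (𝕜 := ℝ) A
      = ∑ i, ∑ j, A i j • Matrix.toEuclideanCLM (n := Fin d) (𝕜 := ℝ) (Matrix.single i j 1) := by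
  conv_lhs => rw [Matrix.matrix_eq_sum_single A]
  simp only [map_sum, ← map_smul, Matrix.smul_single, smul_eq_mul, mul_one]

variable {S : Type*} [MeasurableSpace S] {A : S → Matrix (Fin d) (Fin d) ℝ}

lemma stronglyMeasurable_toEuclideanCLM (hA : ∀ i j, Measurable fun x => A x i j) :
    StronglyMeasurable fun x => Matrix.toEuclideanCLM (n := Fin d) (𝕜 := ℝ) (A x) := by
  simp only [toEuclideanCLM_eq_sum (A _)]
  exact Finset.stronglyMeasurable_fun_sum _ fun i _ => Finset.stronglyMeasurable_fun_sum _
    fun j _ => (hA i j).stronglyMeasurable.smul_const _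

lemma integral_toEuclideanCLM {μ : Measure S} {B : Matrix (Fin d) (Fin d) ℝ}
    (hA : ∀ i j, Integrable (fun x => A x i j) μ) (hB : ∀ i j, ∫ x, A x i j ∂μ = B i j) :
    ∫ x, Matrix.toEuclideanCLM (n := Fin d) (𝕜 := ℝ) (A x) ∂μ
      = Matrix.toEuclideanCLM (n := Fin d) (𝕜 := ℝ) B := by
  rw [toEuclideanCLM_eq_sum B]
  simp_rw [toEuclideanCLM_eq_sum (A _)]
  rw [integral_finsetSum _ fun i _ => integrable_finsetSum _ fun j _ => (hA i j).smul_const _]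
  refine Finset.sum_congr rfl fun i _ => ?_
  rw [integral_finsetSum _ fun j _ => (hA i j).smul_const _]
  exact Finset.sum_congr rfl fun j _ => by rw [integral_smul_const, hB]

end Residual

section Representation

variable {Ω S : Type*} {mΩ : MeasurableSpace Ω} [MeasurableSpace S] {P : Measure Ω}
  [IsProbabilityMeasure P] {κ : Kernel S S} [IsMarkovKernel κ] {μ : Measure S}
  [IsProbabilityMeasure μ] {X : ℕ → Ω → S} {d : ℕ} {A : S → Matrix (Fin d) (Fin d) ℝ}
  {b : S → EuclideanSpace ℝ (Fin d)} {Abar : Matrix (Fin d) (Fin d) ℝ}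
  {bbar θs : EuclideanSpace ℝ (Fin d)} {Amax bmax : ℝ}

lemma IsMarkovChain.integral_residualAt_eq (hX : IsMarkovChain P κ X) (hκ : UniformlyErgodic κ μ)
    (hA_meas : ∀ i j, Measurable fun x => A x i j) (hb_meas : Measurable b)
    (hAbar : ∀ i j, Tendsto (fun t : ℕ => ∫ ω, A (X t ω) i j ∂P) atTop (𝓝 (Abar i j)))
    (hbbar : Tendsto (fun t : ℕ => ∫ ω, b (X t ω) ∂P) atTop (𝓝 bbar))
    (hAmax : ∀ x, ‖A x‖ ≤ Amax) (hbmax : ∀ x, ‖b x‖ ≤ bmax)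
    (hθs : Matrix.toEuclideanLin Abar θs = bbar) :
    ∫ x, residualAt θs (Matrix.toEuclideanCLM (𝕜 := ℝ) (A x), b x) ∂μ
      = (Matrix.toEuclideanCLM (𝕜 := ℝ) Abar, 0) := by
  have hentry (x : S) (i j : Fin d) : ‖A x i j‖ ≤ Amax :=
    (norm_entry_le_frobenius (A x) i j).trans (hAmax x)
  have hA_int (i j : Fin d) : ∫ x, A x i j ∂μ = Abar i j :=
    tendsto_nhds_unique (hX.tendsto_integral hκ (hA_meas i j).stronglyMeasurable (hentry · i j))
      (hAbar i j)
  have hb_int : ∫ x, b x ∂μ = bbar :=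
    tendsto_nhds_unique (hX.tendsto_integral hκ hb_meas.stronglyMeasurable hbmax) hbbar
  have hAi := integrable_of_forall_norm_le (ν := μ) (stronglyMeasurable_toEuclideanCLM hA_meas)
    fun x => (norm_toEuclideanCLM_le_frobenius (A x)).trans (hAmax x)
  have hAij (i j : Fin d) :=
    integrable_of_forall_norm_le (ν := μ) (hA_meas i j).stronglyMeasurable (hentry · i j)
  have hbi := integrable_of_forall_norm_le (ν := μ) hb_meas.stronglyMeasurable hbmax
  rw [(residualAt θs).integral_comp_comm (hAi.prodMk hbi), integral_pair hAi hbi,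
    integral_toEuclideanCLM hAij hA_int, hb_int, residualAt_apply, ← hθs]
  exact Prod.ext rfl (sub_self _)

theorem eqUpToLittleOp_average_plsa (hκ : UniformlyErgodic κ μ)
    (hX : IsMarkovChain P κ X) {W : ℕ → Ω → ℝ} (hW : IsMeanOneWeights P X W)
    (hA_meas : ∀ i j, Measurable fun x => A x i j) (hb_meas : Measurable b)
    (hAbar : ∀ i j, Tendsto (fun t : ℕ => ∫ ω, A (X t ω) i j ∂P) atTop (𝓝 (Abar i j)))
    (hbbar : Tendsto (fun t : ℕ => ∫ ω, b (X t ω) ∂P) atTop (𝓝 bbar))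
    (hHurwitz : IsHurwitz Abar) (hAmax : ∀ x, ‖A x‖ ≤ Amax) (hbmax : ∀ x, ‖b x‖ ≤ bmax)
    {α : ℕ → ℝ} (hα : IsSlowlyDecreasing fun n => α (n + 1))
    (hθs : Matrix.toEuclideanLin Abar θs = bbar) (θ₀ : EuclideanSpace ℝ (Fin d)) :
    EqUpToLittleOp P
      (fun t ω => √(t : ℝ) • (average (plsa α (fun n => W n ω)
        (fun n => A (X n ω)) (fun n => b (X n ω)) θ₀) t - θs))
      (fun t ω => linearTerm Abar (fun n => W n ω)
        (fun n => A (X n ω)) (fun n => b (X n ω)) θs t) := by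
  let f (x : S) := residualAt θs (Matrix.toEuclideanCLM (𝕜 := ℝ) (A x), b x)
  let e (t : ℕ) (ω : Ω) : EuclideanSpace ℝ (Fin d) :=
    plsa α (fun n => W n ω) (fun n => A (X n ω)) (fun n => b (X n ω)) θ₀ t - θs
  have hf : StronglyMeasurable f := (residualAt θs).continuous.comp_stronglyMeasurable
    ((stronglyMeasurable_toEuclideanCLM hA_meas).prodMk hb_meas.stronglyMeasurable)
  have hf_norm (x : S) : ‖f x‖ ≤ ‖residualAt θs‖ * max Amax bmax :=
    (residualAt θs).le_opNorm_of_le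
      (max_le_max ((norm_toEuclideanCLM_le_frobenius (A x)).trans (hAmax x)) (hbmax x))
  have hf_mean : ∫ x, f x ∂μ = (Matrix.toEuclideanCLM (𝕜 := ℝ) Abar, 0) :=
    hX.integral_residualAt_eq hκ hA_meas hb_meas hAbar hbbar hAmax hbmax hθs
  have he_step (t : ℕ) (ω : Ω) : e (t + 1) ω
      = e t ω + α (t + 1) • affineEval (e t ω) (W (t + 1) ω • f (X (t + 1) ω)) :=
    plsa_succ_sub α _ _ _ θ₀ θs t
  obtain ⟨Q, c, hQ⟩ := hHurwitz.exists_isLyapunov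
  have hlinear := tendstoInMeasure_inv_sqrt_smul_sum_linear (u := θ₀ - θs) hQ hα hκ hX hW hf
    hf_norm hf_mean (fun _ => rfl) he_step
  exact (tendstoInMeasure_clm_comp hlinear (Matrix.toEuclideanCLM (𝕜 := ℝ) Abar⁻¹)).congr_left
    fun t => ae_of_all _ fun ω =>
      (sqrt_smul_average_sub_sub_linearTerm hHurwitz.isUnit_det _ _ _ _ θs t).symm

end Representation

end LSA

theorem mainTheorem5_general {Ω S : Type*} [MeasurableSpace Ω] [MeasurableSpace S]
    (P : Measure Ω) [IsProbabilityMeasure P]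
    (κ : Kernel S S) [IsMarkovKernel κ] (μ : Measure S) [IsProbabilityMeasure μ]
    (hergodic : LSA.UniformlyErgodic κ μ)
    (X : ℕ → Ω → S) (hX : LSA.IsMarkovChain P κ X)
    (d : ℕ) (A : S → Matrix (Fin d) (Fin d) ℝ) (b : S → EuclideanSpace ℝ (Fin d))
    (hA_meas : ∀ i j, Measurable fun x => A x i j) (hb_meas : Measurable b)
    (Abar : Matrix (Fin d) (Fin d) ℝ) (bbar : EuclideanSpace ℝ (Fin d))
    (hAbar : ∀ i j, Tendsto (fun t : ℕ => ∫ ω, A (X t ω) i j ∂P) atTop (𝓝 (Abar i j)))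
    (hbbar : Tendsto (fun t : ℕ => ∫ ω, b (X t ω) ∂P) atTop (𝓝 bbar))
    (hHurwitz : LSA.IsHurwitz Abar)
    (Amax bmax : ℝ) (hAmax : ∀ x, ‖A x‖ ≤ Amax) (hbmax : ∀ x, ‖b x‖ ≤ bmax)
    (α : ℕ → ℝ) (hα : LSA.IsSlowlyDecreasing fun n => α (n + 1))
    (θs : EuclideanSpace ℝ (Fin d)) (hθs : Matrix.toEuclideanLin Abar θs = bbar) :
    (∀ W : ℕ → Ω → ℝ, LSA.IsMeanOneWeights P X W → ∀ θhat₀ : EuclideanSpace ℝ (Fin d),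
      LSA.EqUpToLittleOp P
        (fun t ω => Real.sqrt t •
          (LSA.average (LSA.plsa α (fun n => W n ω)
            (fun n => A (X n ω)) (fun n => b (X n ω)) θhat₀) t - θs))
        (fun t ω => LSA.linearTerm Abar (fun n => W n ω)
          (fun n => A (X n ω)) (fun n => b (X n ω)) θs t)) ∧
    (∀ θ₀ : EuclideanSpace ℝ (Fin d),
      LSA.EqUpToLittleOp P
        (fun t ω => Real.sqrt t •
          (LSA.average (LSA.lsa α
            (fun n => A (X n ω)) (fun n => b (X n ω)) θ₀) t - θs))
        (fun t ω => LSA.linearTerm Abar (fun _ => 1)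
          (fun n => A (X n ω)) (fun n => b (X n ω)) θs t)) ∧
    (∀ W : ℕ → Ω → ℝ, LSA.IsMeanOneWeights P X W →
      ∀ θhat₀ θ₀ : EuclideanSpace ℝ (Fin d),
      LSA.EqUpToLittleOp P
        (fun t ω => Real.sqrt t •
          (LSA.average (LSA.plsa α (fun n => W n ω)
              (fun n => A (X n ω)) (fun n => b (X n ω)) θhat₀) t
            - LSA.average (LSA.lsa α
              (fun n => A (X n ω)) (fun n => b (X n ω)) θ₀) t))
        (fun t ω => LSA.linearTerm Abar (fun n => W n ω - 1)
          (fun n => A (X n ω)) (fun n => b (X n ω)) θs t)) := by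
  have hperturbed (W : ℕ → Ω → ℝ) (hW : LSA.IsMeanOneWeights P X W) :=
    LSA.eqUpToLittleOp_average_plsa hergodic hX hW hA_meas hb_meas hAbar hbbar hHurwitz
      hAmax hbmax hα hθs
  have hplain := hperturbed _ LSA.isMeanOneWeights_one
  refine ⟨hperturbed, fun θ₀ => ?_, fun W hW θhat₀ θ₀ => ?_⟩
  · simpa only [LSA.lsa_eq_plsa] using hplain θ₀
  · have hsub := (hperturbed W hW θhat₀).sub (hplain θ₀)
    simpa only [LSA.lsa_eq_plsa, ← smul_sub, sub_sub_sub_cancel_right, LSA.linearTerm_sub]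
      using hsub

theorem mainTheorem5 {Ω S : Type*} [MeasurableSpace Ω] [MeasurableSpace S]
    (P : Measure Ω) [IsProbabilityMeasure P]
    -- the Markov chain
    (κ : Kernel S S) [IsMarkovKernel κ] (μ : Measure S) [IsProbabilityMeasure μ]
    (hergodic : LSA.UniformlyErgodic κ μ)
    (X : ℕ → Ω → S) (hX : LSA.IsMarkovChain P κ X)
    -- the observations
    (d : ℕ) (A : S → Matrix (Fin d) (Fin d) ℝ) (b : S → EuclideanSpace ℝ (Fin d))
    (hA_meas : ∀ i j, Measurable fun x => A x i j) (hb_meas : Measurable b)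
    (Abar : Matrix (Fin d) (Fin d) ℝ) (bbar : EuclideanSpace ℝ (Fin d))
    (hAbar : ∀ i j, Tendsto (fun t : ℕ => ∫ ω, A (X t ω) i j ∂P) atTop (𝓝 (Abar i j)))
    (hbbar : Tendsto (fun t : ℕ => ∫ ω, b (X t ω) ∂P) atTop (𝓝 bbar))
    (hHurwitz : LSA.IsHurwitz Abar)
    (Amax bmax : ℝ) (hAmax : ∀ x, ‖A x‖ ≤ Amax) (hbmax : ∀ x, ‖b x‖ ≤ bmax)
    -- the step sizes
    (α₀ η : ℝ) (hα₀ : 0 < α₀) (hη : η ∈ Set.Ioo (1 / 2 : ℝ) 1)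
    -- the target
    (θs : EuclideanSpace ℝ (Fin d)) (hθs : Matrix.toEuclideanLin Abar θs = bbar) :
    -- representation of the perturbed average
    (∀ W : ℕ → Ω → ℝ, LSA.IsBootstrapWeights P X W → ∀ θhat₀ : EuclideanSpace ℝ (Fin d),
      LSA.EqUpToLittleOp P
        (fun t ω => Real.sqrt t •
          (LSA.average (LSA.plsa (LSA.stepSize α₀ η) (fun n => W n ω)
            (fun n => A (X n ω)) (fun n => b (X n ω)) θhat₀) t - θs))
        (fun t ω => LSA.linearTerm Abar (fun n => W n ω)
          (fun n => A (X n ω)) (fun n => b (X n ω)) θs t)) ∧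
    -- representation of the unperturbed average
    (∀ θ₀ : EuclideanSpace ℝ (Fin d),
      LSA.EqUpToLittleOp P
        (fun t ω => Real.sqrt t •
          (LSA.average (LSA.lsa (LSA.stepSize α₀ η)
            (fun n => A (X n ω)) (fun n => b (X n ω)) θ₀) t - θs))
        (fun t ω => LSA.linearTerm Abar (fun _ => 1)
          (fun n => A (X n ω)) (fun n => b (X n ω)) θs t)) ∧
    -- representation of the bootstrap difference
    (∀ W : ℕ → Ω → ℝ, LSA.IsBootstrapWeights P X W →
      ∀ θhat₀ θ₀ : EuclideanSpace ℝ (Fin d),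
      LSA.EqUpToLittleOp P
        (fun t ω => Real.sqrt t •
          (LSA.average (LSA.plsa (LSA.stepSize α₀ η) (fun n => W n ω)
              (fun n => A (X n ω)) (fun n => b (X n ω)) θhat₀) t
            - LSA.average (LSA.lsa (LSA.stepSize α₀ η)
              (fun n => A (X n ω)) (fun n => b (X n ω)) θ₀) t))
        (fun t ω => LSA.linearTerm Abar (fun n => W n ω - 1)
          (fun n => A (X n ω)) (fun n => b (X n ω)) θs t)) := by
  obtain ⟨hperturbed, hplain, hdiff⟩ := mainTheorem5_general P κ μ hergodic X hX d A b hA_meas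
    hb_meas Abar bbar hAbar hbbar hHurwitz Amax bmax hAmax hbmax (LSA.stepSize α₀ η)
    (LSA.isSlowlyDecreasing_stepSize hα₀ hη) θs hθs
  exact ⟨fun W hW => hperturbed W hW.isMeanOneWeights, hplain,
    fun W hW => hdiff W hW.isMeanOneWeights⟩
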